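/- Let $D\subset\mathbb R^2$ be a nonempty bounded connected open set, let $g$ be a positive continuous function on $\partial D$, let $0<\lambda<\Lambda$, and let $f:\mathbb R^2\to\mathbb R$ be continuous with $\lambda<f<\Lambda$. For $v:\mathbb R^2\setminus D\to[0,\infty)$ put $\Omega(v)=\{x\in\mathbb R^2\setminus D: v(x)>0\}$, and let $\partial\Omega(v)$ be the boundary of $\Omega(v)$ relative to $\mathbb R^2\setminus D$. Consider the one-phase problem $$\Delta u=0\ \text{in }\Omega(u)\setminus D,\qquad u=g\ \text{on }\partial D,\qquad |\nabla u|^2=f\ \text{on }\partial\Omega(u).$$ A continuous $v:\mathbb R^2\setminus D\to[0,\infty)$ is a (viscosity) subsolution if: (1) $\Delta v\ge0$ in the viscosity sense in $\Omega(v)\setminus\overline D$; (2) $v\le g$ on $\partial D$; (3) whenever $x_0\in\partial\Omega(v)\cap\partial B_\rho(y)$ for a ball with $B_\rho(y)\cap\Omega(v)=\emptyset$, and $v(x)\le\alpha\langle x-x_0,\nu\rangle^++o(|x-x_0|)$ as $x\to x_0$, $x\notin D$, with $\nu=(x_0-y)/\rho$, then $\alpha\ge\sqrt{f(x_0)}$.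 Let $p\in D$, $D\subset B_r(p)$, $G\ge\max_{\partial D}g$, and let $$h(x)=G\Big(\frac{\ln(|x-p|/R_0)}{\ln(r/R_0)}\Big)_+,\qquad R_0=\inf\Big\{R>r:\ \frac{G^2}{R^2\ln^2(r/R)}<\lambda\Big\}.$$ Let $u=\sup\{v: v \text{ is a subsolution and } v\le h\}$ be the largest subsolution. Then there are an absolute constant $C>0$ and a constant $K>0$ depending only on $D,g,\lambda,\Lambda$ such that: (a) $u(x)\le K\,\mathrm{dist}(x,\partial\Omega(u))$ for every $x\in\Omega(u)$. (b) $u(x)\le C\sqrt\Lambda\,\mathrm{dist}(x,\partial\Omega(u))$ for every $x\in\Omega(u)$ with $\mathrm{dist}(x,\partial\Omega(u))\le\mathrm{dist}(x,D)$. (c) $u$ is differentiable in $\Omega(u)\setminus\overline D$, and $|\nabla u(x)|\le C\sqrt\Lambda$ for every $x\in\Omega(u)\setminus\overline D$ with $\mathrm{dist}(x,\partial\Omega(u))\le\mathrm{dist}(x,D)$. (d) $u$ is Lipschitz away from $D$: for every $\delta>0$ it is Lipschitz on $\{x:\mathrm{dist}(x,D)\ge\delta\}$ with constant $C\max(\sqrt\Lambda,\,G/\delta)$.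 -/

import Mathlib

open Set Filter Topology Metric
open scoped RealInnerProductSpace

noncomputable section

namespace OnePhase

/-- The Euclidean plane. -/
abbrev Plane : Type := EuclideanSpace ℝ (Fin 2)

/-- The positivity set `Ω(u) = {u > 0}` of a function on `ℝ² \ D`. Functions on `ℝ² \ D` are
written as functions on the plane; their values in `D` are never used. -/
def posSet (D : Set Plane) (u : Plane → ℝ) : Set Plane :=
  {x | x ∉ D ∧ 0 < u x}

/-- The free boundary `∂Ω(u)`: the boundary of `Ω(u)` relative to the closed set `ℝ² \ D` on
which `u` lives. Points of `∂D` at which `u` is positive do not belong to it. -/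
def freeBoundary (D : Set Plane) (u : Plane → ℝ) : Set Plane :=
  Dᶜ ∩ closure (posSet D u) ∩ closure (Dᶜ \ posSet D u)

/-- `Δ u ≥ 0` in `Ω(u) \ D` in the viscosity sense: `C²` functions touching `u` from above at an
interior point have non-negative Laplacian there. The interior of `ℝ² \ D` is `(closure D)ᶜ`. -/
def ViscositySubharmonic (D : Set Plane) (u : Plane → ℝ) : Prop :=
  ∀ x₀ ∈ posSet D u, x₀ ∉ closure D → ∀ φ : Plane → ℝ, ContDiffAt ℝ 2 φ x₀ →
    IsLocalMax (fun x => u x - φ x) x₀ → 0 ≤ Laplacian.laplacian φ x₀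

/-- The subsolution part of `|∇u|² = f` on `∂Ω(u)`. If `B_ρ(y)` lies outside `Ω(u)` and touches
`∂Ω(u)` at `x₀`, the unit normal at `x₀` pointing into `Ω(u)` is `ν = (x₀ - y) / ρ`; whenever
`u(x) ≤ α ⟨x - x₀, ν⟩⁺ + o(|x - x₀|)` near `x₀`, one has `α ≥ √(f x₀)`. -/
def SubFreeBoundaryCondition (D : Set Plane) (f u : Plane → ℝ) : Prop :=
  ∀ x₀ ∈ freeBoundary D u, ∀ (y : Plane) (ρ : ℝ), 0 < ρ →
    Disjoint (ball y ρ) (posSet D u) → x₀ ∈ sphere y ρ →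
    ∀ α : ℝ,
      (∀ ε : ℝ, 0 < ε → ∀ᶠ x in 𝓝[Dᶜ] x₀,
        u x ≤ α * max ⟪x - x₀, ρ⁻¹ • (x₀ - y)⟫ 0 + ε * ‖x - x₀‖) →
      √(f x₀) ≤ α

/-- Viscosity subsolutions `v : ℝ² \ D → [0, ∞)` of the one-phase problem
`Δu = 0` in `Ω(u) \ D`, `u = g` on `∂D`, `|∇u|² = f` on `∂Ω(u)`. -/
structure IsSubsolution (D : Set Plane) (f g v : Plane → ℝ) : Prop where
  continuousOn : ContinuousOn v Dᶜ
  nonneg : ∀ x ∉ D, 0 ≤ v x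
  subharmonic : ViscositySubharmonic D v
  le_boundary : ∀ x ∈ frontier D, v x ≤ g x
  free_boundary : SubFreeBoundaryCondition D f v

/-- The radius `R₀ > r` at which the logarithmic supersolution with value `G` on `∂B_r` and
zero set outside `B_{R₀}` has squared slope `lam`. -/
def outerRadius (lam r G : ℝ) : ℝ :=
  sInf {R : ℝ | r < R ∧ G ^ 2 / (R ^ 2 * Real.log (r / R) ^ 2) < lam}

/-- The radial logarithmic supersolution around `p`, equal to `G` on `∂B_r(p)`. -/
def logSupersolution (lam : ℝ) (p : Plane) (r G : ℝ) (x : Plane) : ℝ :=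
  max (G * (Real.log (dist x p / outerRadius lam r G) / Real.log (r / outerRadius lam r G))) 0

/-- The largest subsolution: the pointwise supremum of all subsolutions below `h`. -/
def largestSubsolution (D : Set Plane) (f g h : Plane → ℝ) (x : Plane) : ℝ :=
  sSup {t : ℝ | ∃ v : Plane → ℝ, IsSubsolution D f g v ∧ (∀ y ∉ D, v y ≤ h y) ∧ v x = t}

end OnePhase

end

noncomputable section

namespace OnePhase

open InnerProductSpace

section LocalMax

variable {E : Type*} [NormedAddCommGroup E] [NormedSpace ℝ E]

theorem fderiv_fderiv_nonpos_of_isLocalMax {φ : E → ℝ} {x : E} (hφ : ContDiffAt ℝ 2 φ x)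
    (hmax : IsLocalMax φ x) (v : E) : fderiv ℝ (fderiv ℝ φ) x v v ≤ 0 := by
  by_contra! hpos
  have hline : Tendsto (fun t : ℝ => x + t • v) (𝓝 0) (𝓝 x) := by
    have : Continuous fun t : ℝ => x + t • v := by fun_prop
    simpa using this.tendsto 0
  have hd1 : ∀ᶠ y in 𝓝 x, DifferentiableAt ℝ φ y := by
    filter_upwards [hφ.eventually (by simp)] with y hy
    exact hy.differentiableAt (by simp)
  have hd2 : DifferentiableAt ℝ (fderiv ℝ φ) x :=
    (hφ.fderiv_right (m := 1) (by norm_num)).differentiableAt (by simp)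
  have hl : ∀ t : ℝ, HasDerivAt (fun t : ℝ => x + t • v) v t := fun t => by
    simpa using ((hasDerivAt_id t).smul_const v).const_add x
  have hγ : ∀ᶠ t in 𝓝 (0 : ℝ), HasDerivAt (fun t : ℝ => φ (x + t • v))
      (fderiv ℝ φ (x + t • v) v) t := by
    filter_upwards [hline.eventually hd1] with t ht
    exact ht.hasFDerivAt.comp_hasDerivAt t (hl t)
  have hγ' : deriv (fun t : ℝ => φ (x + t • v)) =ᶠ[𝓝 0] fun t => fderiv ℝ φ (x + t • v) v := by
    filter_upwards [hγ] with t ht using ht.deriv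
  have hψ : HasDerivAt (fun t : ℝ => fderiv ℝ φ (x + t • v) v)
      (fderiv ℝ (fderiv ℝ φ) x v v) 0 := by
    have h0 : HasFDerivAt (fderiv ℝ φ) (fderiv ℝ (fderiv ℝ φ) x) (x + (0 : ℝ) • v) := by
      simpa using hd2.hasFDerivAt
    have h1 : HasDerivAt (fun t : ℝ => fderiv ℝ φ (x + t • v)) (fderiv ℝ (fderiv ℝ φ) x v) 0 :=
      h0.comp_hasDerivAt 0 (hl 0)
    simpa using h1.clm_apply (hasDerivAt_const 0 v)
  have hdd : deriv (deriv fun t : ℝ => φ (x + t • v)) 0 = fderiv ℝ (fderiv ℝ φ) x v v := by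
    rw [hγ'.deriv_eq, hψ.deriv]
  have hmaxγ : IsLocalMax (fun t : ℝ => φ (x + t • v)) 0 := by
    have := hline.eventually hmax
    simpa [IsLocalMax, IsMaxFilter] using this
  have hminγ : IsLocalMin (fun t : ℝ => φ (x + t • v)) 0 :=
    isLocalMin_of_deriv_deriv_pos (by rwa [hdd]) hmaxγ.deriv_eq_zero
      hγ.self_of_nhds.continuousAt
  have hconst : (fun t : ℝ => φ (x + t • v)) =ᶠ[𝓝 0] fun _ => φ (x + (0 : ℝ) • v) := by
    filter_upwards [hmaxγ, hminγ] with t h1 h2 using le_antisymm h1 h2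
  have : deriv (fun t : ℝ => φ (x + t • v)) =ᶠ[𝓝 0] fun _ => 0 := by
    filter_upwards [hconst.deriv] with t ht
    simpa using ht
  have h0 := this.deriv_eq
  rw [hdd] at h0
  simp at h0
  linarith

end LocalMax

theorem laplacian_nonpos_of_isLocalMax {φ : Plane → ℝ} {x : Plane} (hφ : ContDiffAt ℝ 2 φ x)
    (hmax : IsLocalMax φ x) : Laplacian.laplacian φ x ≤ 0 := by
  rw [laplacian_eq_iteratedFDeriv_stdOrthonormalBasis]
  refine Finset.sum_nonpos fun i _ => ?_
  rw [iteratedFDeriv_two_apply]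
  exact fderiv_fderiv_nonpos_of_isLocalMax hφ hmax _

theorem laplacian_norm_sq_pos (x : Plane) : 0 < Laplacian.laplacian (fun y : Plane => ‖y‖ ^ 2) x := by
  rw [laplacian_eq_iteratedFDeriv_orthonormalBasis _ (EuclideanSpace.basisFun (Fin 2) ℝ)]
  refine Finset.sum_pos (fun i _ => ?_) ⟨0, by simp⟩
  rw [iteratedFDeriv_two_apply]
  have h1 : fderiv ℝ (fun y : Plane => ‖y‖ ^ 2) = fun y => (2 : ℕ) • innerSL ℝ y := by
    ext1 y
    exact (hasStrictFDerivAt_norm_sq y).hasFDerivAt.fderiv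
  rw [h1]
  have h2 : HasFDerivAt (fun y : Plane => (2 : ℕ) • innerSL ℝ y) ((2 : ℕ) • innerSL ℝ) x :=
    ((2 : ℕ) • innerSL ℝ (E := Plane)).hasFDerivAt
  rw [h2.fderiv]
  have h3 : ‖EuclideanSpace.basisFun (Fin 2) ℝ i‖ = 1 := by simp
  change 0 < ((2 : ℕ) • innerSL ℝ (E := Plane)) (EuclideanSpace.basisFun (Fin 2) ℝ i)
    (EuclideanSpace.basisFun (Fin 2) ℝ i)
  rw [two_smul, add_apply, add_apply, innerSL_apply_apply,
    real_inner_self_eq_norm_sq, h3]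
  norm_num

/-- The standard isometry between the plane and `ℂ`. -/
def toC : Plane ≃ₗᵢ[ℝ] ℂ := Complex.orthonormalBasisOneI.repr.symm

theorem laplacian_comp_toC (f : ℂ → ℝ) (x : Plane) :
    Laplacian.laplacian (f ∘ toC) x = Laplacian.laplacian f (toC x) := by
  rw [laplacian_eq_iteratedFDeriv_orthonormalBasis _ (EuclideanSpace.basisFun (Fin 2) ℝ),
    laplacian_eq_iteratedFDeriv_orthonormalBasis _ Complex.orthonormalBasisOneI]
  refine Finset.sum_congr rfl fun i _ => ?_
  have := toC.toContinuousLinearEquiv.iteratedFDerivWithin_comp_right (𝕜 := ℝ) f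
    uniqueDiffOn_univ (mem_univ (toC x)) 2
  simp only [preimage_univ, iteratedFDerivWithin_univ] at this
  have h2 : f ∘ toC = f ∘ toC.toContinuousLinearEquiv := rfl
  rw [h2, this]
  simp only [ContinuousMultilinearMap.compContinuousLinearMap_apply]
  congr 1
  ext j
  fin_cases j <;> simp [toC]

theorem harmonicAt_comp_toC {f : ℂ → ℝ} {x : Plane} (h : HarmonicAt f (toC x)) :
    HarmonicAt (f ∘ toC) x := by
  refine ⟨h.1.comp x toC.toContinuousLinearEquiv.contDiff.contDiffAt, ?_⟩
  have := toC.continuous.continuousAt.eventually h.2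
  filter_upwards [this] with y hy
  rw [laplacian_comp_toC, hy]
  rfl

theorem harmonicAt_comp_toC_symm {f : Plane → ℝ} {z : ℂ} (h : HarmonicAt f (toC.symm z)) :
    HarmonicAt (f ∘ toC.symm) z := by
  have hc : ContDiffAt ℝ 2 (f ∘ toC.symm) z :=
    h.1.comp z toC.symm.toContinuousLinearEquiv.contDiff.contDiffAt
  refine ⟨hc, ?_⟩
  have := toC.symm.continuous.continuousAt.eventually h.2
  filter_upwards [this] with y hy
  have h3 := laplacian_comp_toC (f ∘ toC.symm) (toC.symm y)
  have h4 : (f ∘ toC.symm) ∘ toC = f := by ext; simp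
  rw [h4, hy] at h3
  simpa using h3.symm

theorem harmonicAt_comp_sub {f : Plane → ℝ} {x c : Plane} (h : HarmonicAt f (x - c)) :
    HarmonicAt (fun y => f (y - c)) x := by
  have hs : ContDiffAt ℝ 2 (fun y : Plane => y - c) x := by fun_prop
  refine ⟨ContDiffAt.comp x h.1 hs, ?_⟩
  have := (hs.continuousAt.tendsto).eventually h.2
  filter_upwards [this] with y hy
  rw [laplacian_eq_iteratedFDeriv_stdOrthonormalBasis] at hy ⊢
  simp only [iteratedFDeriv_comp_sub]
  exact hy

theorem harmonicAt_log_dist {p x : Plane} (h : x ≠ p) : HarmonicAt (fun y => Real.log (dist y p)) x := by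
  have h1 : HarmonicAt (fun z : ℂ => Real.log ‖z - toC p‖) (toC x) := by
    apply AnalyticAt.harmonicAt_log_norm
    · fun_prop
    · simpa [sub_eq_zero] using h
  have h2 := harmonicAt_comp_toC h1
  convert h2 using 2 with y
  simp [← map_sub, dist_eq_norm]

section PoissonIntegral

open Real

/-- The Poisson integral over the circle of radius `R` about the origin. -/
def poissonIntegral (R : ℝ) (φ : ℂ → ℝ) (w : ℂ) : ℝ :=
  circleAverage (poissonKernel 0 w • φ) 0 R

theorem continuousOn_poissonKernel {R : ℝ} {w : ℂ} (hw : w ∈ ball (0 : ℂ) R) :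
    ContinuousOn (poissonKernel 0 w) (sphere 0 |R|) := by
  rw [poissonKernel_eq_re_herglotzRieszKernel]
  exact Complex.continuous_re.comp_continuousOn (continuousOn_herglotzRieszKernel_sphere hw)

theorem circleIntegrable_poissonKernel_smul {R : ℝ} {w : ℂ} {φ : ℂ → ℝ}
    (hφ : CircleIntegrable φ 0 R) (hw : w ∈ ball (0 : ℂ) R) :
    CircleIntegrable (poissonKernel 0 w • φ) 0 R :=
  hφ.continuousOn_smul (continuousOn_poissonKernel hw)

theorem harmonicOnNhd_poissonIntegral {R : ℝ} {φ : ℂ → ℝ} (hφ : CircleIntegrable φ 0 R) :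
    HarmonicOnNhd (poissonIntegral R φ) (ball 0 R) := by
  intro w hw
  have hc : CircleIntegrable (fun ζ => (φ ζ : ℂ)) 0 R := by
    simp only [CircleIntegrable, intervalIntegrable_iff] at hφ ⊢
    exact Complex.ofRealCLM.integrable_comp hφ
  have han := (analyticOnNhd_circleAverage_herglotzRieszKernel_smul hc w hw).harmonicAt_re
  refine (harmonicAt_congr_nhds ?_).1 han
  filter_upwards [isOpen_ball.mem_nhds hw] with y hy
  rw [re_circleAverage_herglotzRieszKernel_smul hφ hy, poissonIntegral,
    poissonKernel_eq_re_herglotzRieszKernel]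

theorem poissonKernel_nonneg {R : ℝ} {w z : ℂ} (hw : w ∈ ball (0 : ℂ) R)
    (hz : z ∈ sphere (0 : ℂ) R) : 0 ≤ poissonKernel 0 w z := by
  rw [poissonKernel_def]
  simp only [mem_ball, dist_zero_right, mem_sphere] at hw hz
  have := norm_nonneg w
  refine div_nonneg ?_ (by positivity)
  simp only [sub_zero, hz]
  nlinarith

theorem poissonIntegral_const {R : ℝ} {w : ℂ} (hw : w ∈ ball (0 : ℂ) R) (a : ℝ) :
    poissonIntegral R (fun _ => a) w = a :=
  HarmonicOnNhd.circleAverage_poissonKernel_smul (f := fun _ => a) (harmonicOnNhd_const a) hw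

theorem poissonIntegral_sub {R : ℝ} {w : ℂ} {φ ψ : ℂ → ℝ} (hw : w ∈ ball (0 : ℂ) R)
    (hφ : CircleIntegrable φ 0 R) (hψ : CircleIntegrable ψ 0 R) :
    poissonIntegral R φ w - poissonIntegral R ψ w = poissonIntegral R (φ - ψ) w := by
  rw [poissonIntegral, poissonIntegral, poissonIntegral, smul_sub,
    circleAverage_sub (circleIntegrable_poissonKernel_smul hφ hw)
      (circleIntegrable_poissonKernel_smul hψ hw)]

theorem abs_poissonIntegral_sub_le {R ε δ M : ℝ} {φ : ℂ → ℝ} {w ζ : ℂ}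
    (hφ : CircleIntegrable φ 0 R) (hε : 0 ≤ ε) (hδ : 0 < δ) (hM : ∀ z ∈ sphere (0 : ℂ) R, |φ z| ≤ M)
    (hζ : ζ ∈ sphere (0 : ℂ) R)
    (hc : ∀ z ∈ sphere (0 : ℂ) R, dist z ζ < δ → |φ z - φ ζ| ≤ ε)
    (hw : w ∈ ball (0 : ℂ) R) (hwζ : dist w ζ < δ / 2) :
    |poissonIntegral R φ w - φ ζ| ≤ ε + 2 * M * ((R ^ 2 - ‖w‖ ^ 2) / (δ / 2) ^ 2) := by
  have hR : 0 < R := pos_of_mem_ball hw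
  have hwR : ‖w‖ < R := by simpa using hw
  have hM0 : 0 ≤ M := (abs_nonneg _).trans (hM ζ hζ)
  have hconst : CircleIntegrable (fun _ : ℂ => φ ζ) 0 R := circleIntegrable_const _ _ _
  have hK0 : CircleIntegrable (poissonKernel 0 w • (fun _ : ℂ => ε)) 0 R :=
    circleIntegrable_poissonKernel_smul (circleIntegrable_const _ _ _) hw
  have e1 : poissonIntegral R φ w - φ ζ = poissonIntegral R (φ - fun _ => φ ζ) w := by
    rw [← poissonIntegral_sub hw hφ hconst, poissonIntegral_const hw]
  rw [e1, poissonIntegral]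
  refine abs_circleAverage_le_circleAverage_abs.trans ?_
  have hnn : 0 ≤ (R ^ 2 - ‖w‖ ^ 2) / (δ / 2) ^ 2 := by
    refine div_nonneg ?_ (by positivity)
    nlinarith [norm_nonneg w]
  calc _ ≤ circleAverage (poissonKernel 0 w • (fun _ : ℂ => ε) +
        fun _ => 2 * M * ((R ^ 2 - ‖w‖ ^ 2) / (δ / 2) ^ 2)) 0 R := by
        refine circleAverage_mono ?_ ?_ ?_
        · exact (circleIntegrable_poissonKernel_smul (hφ.sub hconst) hw).abs
        · exact hK0.add (circleIntegrable_const _ _ _)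
        · intro z hz
          rw [abs_of_pos hR] at hz
          have hP := poissonKernel_nonneg hw hz
          change |poissonKernel 0 w z * (φ z - φ ζ)| ≤ poissonKernel 0 w z * ε +
            2 * M * ((R ^ 2 - ‖w‖ ^ 2) / (δ / 2) ^ 2)
          rw [abs_mul, abs_of_nonneg hP]
          by_cases hzζ : dist z ζ < δ
          · have := mul_le_mul_of_nonneg_left (hc z hz hzζ) hP
            have : 0 ≤ 2 * M * ((R ^ 2 - ‖w‖ ^ 2) / (δ / 2) ^ 2) := by positivity
            linarith
          · push Not at hzζ
            have h1 : |φ z - φ ζ| ≤ 2 * M := by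
              have := abs_sub (φ z) (φ ζ)
              linarith [hM z hz, hM ζ hζ]
            have h2 : δ / 2 ≤ ‖z - w‖ := by
              rw [← dist_eq_norm]
              linarith [dist_triangle z w ζ]
            have h3 : poissonKernel 0 w z ≤ (R ^ 2 - ‖w‖ ^ 2) / (δ / 2) ^ 2 := by
              rw [poissonKernel_def]
              simp only [sub_zero]
              have hzR : ‖z‖ = R := by simpa using hz
              rw [hzR]
              gcongr
              nlinarith [norm_nonneg w]
            have h4 : poissonKernel 0 w z * |φ z - φ ζ| ≤
                (R ^ 2 - ‖w‖ ^ 2) / (δ / 2) ^ 2 * (2 * M) :=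
              mul_le_mul h3 h1 (abs_nonneg _) hnn
            have h5 := mul_nonneg hP hε
            linarith
    _ = ε + 2 * M * ((R ^ 2 - ‖w‖ ^ 2) / (δ / 2) ^ 2) := by
        rw [circleAverage_add hK0 (circleIntegrable_const _ _ _), circleAverage_const]
        congr 1
        exact poissonIntegral_const hw ε

open Classical in
/-- The solution of the Dirichlet problem on a disc about the origin. -/
theorem exists_harmonic_extension_complex {R : ℝ} (hR : 0 < R) {φ : ℂ → ℝ}
    (hφ : ContinuousOn φ (sphere 0 R)) :
    ∃ H : ℂ → ℝ, ContinuousOn H (closedBall 0 R) ∧ HarmonicOnNhd H (ball 0 R) ∧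
      EqOn H φ (sphere 0 R) := by
  have hint : CircleIntegrable φ 0 R := hφ.circleIntegrable hR.le
  set H : ℂ → ℝ := fun w => if ‖w‖ < R then poissonIntegral R φ w else φ w with hH
  have hHball : EqOn H (poissonIntegral R φ) (ball 0 R) := fun w hw => by
    have : ‖w‖ < R := by simpa using hw
    simp [hH, this]
  have hHsph : EqOn H φ (sphere 0 R) := fun w hw => by
    have : ‖w‖ = R := by simpa using hw
    simp [hH, this]
  have hharm : HarmonicOnNhd H (ball 0 R) := fun w hw =>
    (harmonicAt_congr_nhds (hHball.eventuallyEq_of_mem (isOpen_ball.mem_nhds hw))).2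
      (harmonicOnNhd_poissonIntegral hint w hw)
  refine ⟨H, ?_, hharm, hHsph⟩
  intro ζ hζ
  rcases (mem_closedBall.1 hζ).lt_or_eq with hlt | heq
  · exact (hharm ζ hlt).1.continuousAt.continuousWithinAt
  have hζs : ζ ∈ sphere (0 : ℂ) R := heq
  obtain ⟨M, hM⟩ := (isCompact_sphere (0 : ℂ) R).exists_bound_of_continuousOn hφ
  simp only [Real.norm_eq_abs] at hM
  rw [ContinuousWithinAt, Metric.tendsto_nhds]
  intro ε hε
  obtain ⟨δ, hδ, hc⟩ := Metric.continuousOn_iff.1 hφ ζ hζs (ε / 2) (by positivity)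
  have hlim : Tendsto (fun w : ℂ => ε / 2 + 2 * M * ((R ^ 2 - ‖w‖ ^ 2) / (δ / 2) ^ 2)) (𝓝 ζ)
      (𝓝 (ε / 2)) := by
    have : Continuous fun w : ℂ => ε / 2 + 2 * M * ((R ^ 2 - ‖w‖ ^ 2) / (δ / 2) ^ 2) := by fun_prop
    have h2 := this.tendsto ζ
    have h3 : ‖ζ‖ = R := by simpa using hζs
    simpa [h3] using h2
  have hev := hlim.eventually (gt_mem_nhds (half_lt_self hε))
  rw [hHsph hζs]
  filter_upwards [nhdsWithin_le_nhds hev, self_mem_nhdsWithin,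
    nhdsWithin_le_nhds (ball_mem_nhds ζ (half_pos hδ))] with w hw1 hw2 hw3
  rcases (mem_closedBall.1 hw2).lt_or_eq with hlt | heq'
  · rw [hHball hlt, Real.dist_eq]
    refine lt_of_le_of_lt ?_ hw1
    refine abs_poissonIntegral_sub_le hint (by positivity) hδ hM hζs ?_ hlt hw3
    intro z hz hzd
    exact (hc z hz hzd).le
  · have hws : w ∈ sphere (0 : ℂ) R := heq'
    rw [hHsph hws]
    have := hc w hws (lt_trans hw3 (half_lt_self hδ))
    linarith

theorem harmonicOnNhd_of_tendsto_complex {R M : ℝ} {H : ℕ → ℂ → ℝ} {V : ℂ → ℝ}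
    (hH : ∀ n, HarmonicOnNhd (H n) (ball 0 R)) (hM : ∀ n, ∀ z ∈ ball (0 : ℂ) R, |H n z| ≤ M)
    (hlim : ∀ z ∈ ball (0 : ℂ) R, Tendsto (fun n => H n z) atTop (𝓝 (V z))) :
    HarmonicOnNhd V (ball 0 R) := by
  intro w hw
  have hw' : ‖w‖ < R := by simpa using hw
  obtain ⟨s, hs1, hs2⟩ := exists_between hw'
  have hs0 : 0 < s := (norm_nonneg w).trans_lt hs1
  have hcirc : ∀ θ, circleMap 0 s θ ∈ ball (0 : ℂ) R := fun θ => by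
    simpa [abs_of_pos hs0] using hs2
  have hsub : closedBall (0 : ℂ) s ⊆ ball 0 R := closedBall_subset_ball hs2
  have hmeas : Measurable fun θ => V (circleMap 0 s θ) := by
    refine measurable_of_tendsto_metrizable (f := fun n θ => H n (circleMap 0 s θ)) (fun n => ?_) ?_
    · refine Continuous.measurable ?_
      exact ((hH n).continuousOn).comp_continuous (continuous_circleMap 0 s) hcirc
    · rw [tendsto_pi_nhds]
      exact fun θ => hlim _ (hcirc θ)
  have hVM : ∀ z ∈ ball (0 : ℂ) R, |V z| ≤ M := fun z hz =>
    le_of_tendsto (hlim z hz).abs (Eventually.of_forall fun n => hM n z hz)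
  have hVint : CircleIntegrable V 0 s := by
    have hb : IntervalIntegrable (fun _ : ℝ => M) MeasureTheory.volume 0 (2 * π) :=
      intervalIntegrable_const
    refine hb.mono_fun hmeas.aestronglyMeasurable (Eventually.of_forall fun θ => ?_)
    exact (hVM _ (hcirc θ)).trans (le_abs_self M)
  have hrep : EqOn V (poissonIntegral s V) (ball 0 s) := by
    intro y hy
    have h1 : ∀ n, poissonIntegral s (H n) y = H n y := fun n =>
      HarmonicOnNhd.circleAverage_poissonKernel_smul ((hH n).mono hsub) hy
    refine tendsto_nhds_unique (hlim y (ball_subset_ball hs2.le hy)) ?_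
    simp_rw [← h1]
    unfold poissonIntegral circleAverage
    refine Tendsto.const_smul ?_ _
    have hKc : Continuous fun θ => poissonKernel 0 y (circleMap 0 s θ) :=
      (continuousOn_poissonKernel hy).comp_continuous (continuous_circleMap 0 s)
        fun θ => circleMap_mem_sphere' 0 s θ
    refine intervalIntegral.tendsto_integral_filter_of_dominated_convergence
      (fun θ => |poissonKernel 0 y (circleMap 0 s θ)| * M) ?_ ?_ ?_ ?_
    · refine Eventually.of_forall fun n => ?_
      refine Continuous.aestronglyMeasurable ?_
      exact hKc.smul (((hH n).continuousOn).comp_continuous (continuous_circleMap 0 s) hcirc)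
    · refine Eventually.of_forall fun n => Eventually.of_forall fun θ _ => ?_
      simp only [Pi.smul_apply', smul_eq_mul, norm_mul, Real.norm_eq_abs]
      exact mul_le_mul_of_nonneg_left (hM n _ (hcirc θ)) (abs_nonneg _)
    · exact (hKc.abs.mul continuous_const).intervalIntegrable _ _
    · refine Eventually.of_forall fun θ _ => ?_
      exact (hlim _ (hcirc θ)).const_mul _
  have hws : w ∈ ball (0 : ℂ) s := by simpa using hs1
  exact (harmonicAt_congr_nhds (hrep.eventuallyEq_of_mem (isOpen_ball.mem_nhds hws))).2
    (harmonicOnNhd_poissonIntegral hVint w hws)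

theorem harnack_complex {s : ℝ} {H : ℂ → ℝ} (hH : HarmonicOnNhd H (closedBall 0 s))
    (hnn : ∀ z ∈ closedBall (0 : ℂ) s, 0 ≤ H z) {w : ℂ} (hw : w ∈ ball (0 : ℂ) s) :
    (s - ‖w‖) / (s + ‖w‖) * H 0 ≤ H w ∧ H w ≤ (s + ‖w‖) / (s - ‖w‖) * H 0 := by
  have hs : 0 < s := pos_of_mem_ball hw
  have hint : CircleIntegrable H 0 s :=
    (hH.continuousOn.mono sphere_subset_closedBall).circleIntegrable hs.le
  have h0 : circleAverage H 0 s = H 0 :=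
    InnerProductSpace.HarmonicOnNhd.circleAverage_eq (by rwa [abs_of_pos hs])
  have h1 : circleAverage (poissonKernel 0 w • H) 0 s = H w :=
    HarmonicOnNhd.circleAverage_poissonKernel_smul hH hw
  have hK := circleIntegrable_poissonKernel_smul hint hw
  constructor
  · rw [← h0, ← h1, ← smul_eq_mul, ← circleAverage_smul]
    refine circleAverage_mono hint.const_smul hK fun z hz => ?_
    rw [abs_of_pos hs] at hz
    have := le_re_herglotzRieszKernel hz hw
    simp only [Pi.smul_apply, Pi.smul_apply', smul_eq_mul]
    refine mul_le_mul_of_nonneg_right ?_ (hnn z (sphere_subset_closedBall hz))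
    rw [poissonKernel_eq_re_herglotzRieszKernel]
    simpa [herglotzRieszKernel_def] using this
  · rw [← h0, ← h1, ← smul_eq_mul, ← circleAverage_smul]
    refine circleAverage_mono hK hint.const_smul fun z hz => ?_
    rw [abs_of_pos hs] at hz
    have := re_herglotzRieszKernel_le hz hw
    simp only [Pi.smul_apply, Pi.smul_apply', smul_eq_mul]
    refine mul_le_mul_of_nonneg_right ?_ (hnn z (sphere_subset_closedBall hz))
    rw [poissonKernel_eq_re_herglotzRieszKernel]
    simpa [herglotzRieszKernel_def] using this

end PoissonIntegral

theorem harmonicAt_comp_toC_sub {H : ℂ → ℝ} {x c : Plane} (h : HarmonicAt H (toC (x - c))) :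
    HarmonicAt (fun y => H (toC (y - c))) x :=
  harmonicAt_comp_sub (f := H ∘ toC) (harmonicAt_comp_toC h)

theorem harmonicAt_comp_toC_symm_add {H : Plane → ℝ} {z : ℂ} {c : Plane}
    (h : HarmonicAt H (toC.symm z + c)) : HarmonicAt (fun w => H (toC.symm w + c)) z := by
  refine harmonicAt_comp_toC_symm (f := fun y => H (y + c)) ?_
  have := harmonicAt_comp_sub (f := H) (x := toC.symm z) (c := -c) (by simpa using h)
  simpa using this

theorem norm_toC_sub (x c : Plane) : ‖toC x - toC c‖ = dist x c := by
  rw [← map_sub, LinearIsometryEquiv.norm_map, dist_eq_norm]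

/-- The Dirichlet problem on a disc is solvable for continuous boundary values. -/
theorem exists_harmonic_extension {c : Plane} {R : ℝ} (hR : 0 < R) {φ : Plane → ℝ}
    (hφ : ContinuousOn φ (sphere c R)) :
    ∃ H : Plane → ℝ, ContinuousOn H (closedBall c R) ∧ HarmonicOnNhd H (ball c R) ∧
      EqOn H φ (sphere c R) := by
  obtain ⟨H, h1, h2, h3⟩ := exists_harmonic_extension_complex hR
    (φ := fun z => φ (toC.symm z + c)) (by
      refine hφ.comp (by fun_prop) fun z hz => ?_
      simpa using hz)
  refine ⟨fun y => H (toC (y - c)), ?_, ?_, ?_⟩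
  · refine h1.comp (by fun_prop) fun x hx => ?_
    simpa [norm_toC_sub] using hx
  · intro x hx
    exact harmonicAt_comp_toC_sub (h2 _ (by simpa [norm_toC_sub] using hx))
  · intro x hx
    have := h3 (x := toC (x - c)) (by simpa [norm_toC_sub, -mem_sphere_iff_norm] using hx)
    simpa using this

/-- A bounded pointwise limit of harmonic functions on a disc is harmonic. -/
theorem harmonicOnNhd_of_tendsto {c : Plane} {R M : ℝ} {H : ℕ → Plane → ℝ} {V : Plane → ℝ}
    (hH : ∀ n, HarmonicOnNhd (H n) (ball c R)) (hM : ∀ n, ∀ z ∈ ball c R, |H n z| ≤ M)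
    (hlim : ∀ z ∈ ball c R, Tendsto (fun n => H n z) atTop (𝓝 (V z))) :
    HarmonicOnNhd V (ball c R) := by
  have hmem : ∀ z ∈ ball (0 : ℂ) R, toC.symm z + c ∈ ball c R := fun z hz => by
    simpa using hz
  have := harmonicOnNhd_of_tendsto_complex (R := R) (M := M)
    (H := fun n z => H n (toC.symm z + c)) (V := fun z => V (toC.symm z + c))
    (fun n z hz => harmonicAt_comp_toC_symm_add (hH n _ (hmem z hz)))
    (fun n z hz => hM n _ (hmem z hz)) (fun z hz => hlim _ (hmem z hz))
  intro x hx
  have h2 := harmonicAt_comp_toC_sub (x := x) (c := c)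
    (this _ (by simpa [norm_toC_sub] using hx))
  simpa using h2

theorem harnack_of_closedBall {x : Plane} {s : ℝ} {H : Plane → ℝ}
    (hH : HarmonicOnNhd H (closedBall x s)) (hnn : ∀ z ∈ closedBall x s, 0 ≤ H z) {y : Plane}
    (hy : y ∈ ball x s) :
    (s - dist y x) / (s + dist y x) * H x ≤ H y ∧
      H y ≤ (s + dist y x) / (s - dist y x) * H x := by
  have hmem : ∀ z ∈ closedBall (0 : ℂ) s, toC.symm z + x ∈ closedBall x s := fun z hz => by
    simpa using hz
  have := harnack_complex (s := s) (H := fun z => H (toC.symm z + x))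
    (fun z hz => harmonicAt_comp_toC_symm_add (hH _ (hmem z hz)))
    (fun z hz => hnn _ (hmem z hz)) (w := toC (y - x)) (by simpa [norm_toC_sub] using hy)
  simpa [norm_toC_sub] using this

theorem harnack_half {x : Plane} {d : ℝ} (hd : 0 < d) {H : Plane → ℝ}
    (hH : HarmonicOnNhd H (ball x d)) (hnn : ∀ z ∈ ball x d, 0 ≤ H z) {y : Plane}
    (hy : y ∈ closedBall x (d / 2)) : H x / 5 ≤ H y := by
  have hsub : closedBall x (3 / 4 * d) ⊆ ball x d := closedBall_subset_ball (by linarith)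
  have hy' : dist y x ≤ d / 2 := hy
  have hHx := hnn x (mem_ball_self hd)
  have := (harnack_of_closedBall (hH.mono hsub) (fun z hz => hnn z (hsub hz)) (y := y)
    (by rw [mem_ball]; linarith)).1
  refine le_trans ?_ this
  rw [div_eq_inv_mul]
  refine mul_le_mul_of_nonneg_right ?_ hHx
  have := dist_nonneg (x := y) (y := x)
  rw [le_div_iff₀ (by positivity)]
  linarith

theorem norm_fderiv_le_of_harmonic {x : Plane} {d : ℝ} (hd : 0 < d) {H : Plane → ℝ}
    (hH : HarmonicOnNhd H (ball x d)) (hnn : ∀ z ∈ ball x d, 0 ≤ H z) :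
    ‖fderiv ℝ H x‖ ≤ 8 * H x / d := by
  have hHx := hnn x (mem_ball_self hd)
  refine norm_fderiv_le_of_lip' ℝ (by positivity) ?_
  have hsub : closedBall x (3 / 4 * d) ⊆ ball x d := closedBall_subset_ball (by linarith)
  filter_upwards [ball_mem_nhds x (show (0 : ℝ) < d / 2 by positivity)] with y hy
  have hy' : dist y x < d / 2 := hy
  have h0 := dist_nonneg (x := y) (y := x)
  obtain ⟨h1, h2⟩ := harnack_of_closedBall (hH.mono hsub) (fun z hz => hnn z (hsub hz)) (y := y)
    (by rw [mem_ball]; linarith)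
  rw [← dist_eq_norm y x, Real.norm_eq_abs, abs_le]
  set t := dist y x
  have hk : 8 * t / d * d = 8 * t := div_mul_cancel₀ _ hd.ne'
  have hk0 : 0 ≤ 8 * t / d := by positivity
  have e1 : (3 / 4 * d - t) / (3 / 4 * d + t) ≥ 1 - 8 * t / d := by
    rw [ge_iff_le, le_div_iff₀ (by positivity)]
    nlinarith
  have e2 : (3 / 4 * d + t) / (3 / 4 * d - t) ≤ 1 + 8 * t / d := by
    rw [div_le_iff₀ (by linarith)]
    nlinarith
  have e3 := mul_le_mul_of_nonneg_right e1.le hHx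
  have e4 := mul_le_mul_of_nonneg_right e2 hHx
  have e5 : 8 * H x / d * t = 8 * t / d * H x := by ring
  rw [e5]
  constructor <;> nlinarith

/-- `Δ v ≥ 0` at `x₀` in the viscosity sense. -/
def ViscSubAt (v : Plane → ℝ) (x₀ : Plane) : Prop :=
  ∀ φ : Plane → ℝ, ContDiffAt ℝ 2 φ x₀ → IsLocalMax (fun x => v x - φ x) x₀ →
    0 ≤ Laplacian.laplacian φ x₀

theorem ViscSubAt.of_le {v w : Plane → ℝ} {x : Plane} (hw : ViscSubAt w x)
    (hle : w ≤ᶠ[𝓝 x] v) (heq : w x = v x) : ViscSubAt v x := by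
  intro φ hφ hmax
  refine hw φ hφ ?_
  filter_upwards [hmax, hle] with y h1 h2
  linarith

theorem viscSubAt_of_harmonicAt {H : Plane → ℝ} {x : Plane} (hH : HarmonicAt H x) :
    ViscSubAt H x := by
  intro φ hφ hmax
  have h1 := laplacian_nonpos_of_isLocalMax (hH.1.sub hφ) hmax
  have h2 := hH.1.laplacian_sub hφ
  have h3 : Laplacian.laplacian H x = 0 := hH.2.self_of_nhds
  have h4 : Laplacian.laplacian (H - φ) x ≤ 0 := h1
  linarith

/-- Comparison of a viscosity subharmonic function with a harmonic one. -/
theorem le_of_viscSubAt {U : Set Plane} (hU : IsOpen U) (hb : Bornology.IsBounded U)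
    {v H : Plane → ℝ} (hv : ContinuousOn v (closure U)) (hH : ContinuousOn H (closure U))
    (hharm : HarmonicOnNhd H U) (hsub : ∀ x ∈ U, H x < v x → ViscSubAt v x)
    (hbd : ∀ x ∈ frontier U, v x ≤ H x) : ∀ x ∈ closure U, v x ≤ H x := by
  by_contra! hcon
  obtain ⟨x₁, hx₁, hlt⟩ := hcon
  obtain ⟨B, hB⟩ := hb.closure.exists_norm_le
  set η := v x₁ - H x₁ with hη
  have hη0 : 0 < η := sub_pos.2 hlt
  set ε := η / (2 * (B ^ 2 + 1)) with hε
  have hε0 : 0 < ε := by positivity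
  have hεB : ε * B ^ 2 < η := by
    have : ε * (2 * (B ^ 2 + 1)) = η := div_mul_cancel₀ _ (by positivity)
    nlinarith [sq_nonneg B]
  have hcomp : IsCompact (closure U) := hb.isCompact_closure
  obtain ⟨x₀, hx₀, hmax⟩ := hcomp.exists_isMaxOn ⟨x₁, hx₁⟩
    (f := fun x => v x - (H x - ε * ‖x‖ ^ 2)) (by fun_prop)
  have hge : η ≤ v x₀ - (H x₀ - ε * ‖x₀‖ ^ 2) := by
    have h1 : v x₁ - (H x₁ - ε * ‖x₁‖ ^ 2) ≤ _ := hmax hx₁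
    have h2 : 0 ≤ ε * ‖x₁‖ ^ 2 := by positivity
    simp only at h1
    linarith
  have hB0 : ‖x₀‖ ^ 2 ≤ B ^ 2 := by
    have := hB x₀ hx₀
    have := norm_nonneg x₀
    nlinarith
  have hpos : H x₀ < v x₀ := by nlinarith
  have hx₀U : x₀ ∈ U := by
    by_contra hn
    have : x₀ ∈ frontier U := ⟨hx₀, by rwa [hU.interior_eq]⟩
    linarith [hbd x₀ this]
  have hnsq : ContDiffAt ℝ 2 (fun x : Plane => ‖x‖ ^ 2) x₀ := (contDiff_norm_sq ℝ).contDiffAt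
  have hεnsq : ContDiffAt ℝ 2 (ε • fun x : Plane => ‖x‖ ^ 2) x₀ := hnsq.const_smul ε
  have hloc : IsLocalMax (fun x => v x - (H - ε • fun x : Plane => ‖x‖ ^ 2 : Plane → ℝ) x) x₀ := by
    filter_upwards [hU.mem_nhds hx₀U] with y hy
    exact hmax (subset_closure hy)
  have hLap := hsub x₀ hx₀U hpos (H - ε • fun x : Plane => ‖x‖ ^ 2)
    ((hharm x₀ hx₀U).1.sub hεnsq) hloc
  rw [(hharm x₀ hx₀U).1.laplacian_sub hεnsq, laplacian_smul ε hnsq] at hLap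
  have h3 : Laplacian.laplacian H x₀ = 0 := (hharm x₀ hx₀U).2.self_of_nhds
  have h4 := laplacian_norm_sq_pos x₀
  rw [h3, smul_eq_mul] at hLap
  nlinarith

section FreeBoundary

variable {D : Set Plane} {f g h v w : Plane → ℝ} {x : Plane}

/-- The subsolution part of the free boundary condition at one point. -/
def SubFBAt (D : Set Plane) (f u : Plane → ℝ) (x₀ : Plane) : Prop :=
  ∀ (y : Plane) (ρ : ℝ), 0 < ρ → Disjoint (ball y ρ) (posSet D u) → x₀ ∈ sphere y ρ →
    ∀ α : ℝ,
      (∀ ε : ℝ, 0 < ε → ∀ᶠ x in 𝓝[Dᶜ] x₀,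
        u x ≤ α * max ⟪x - x₀, ρ⁻¹ • (x₀ - y)⟫ 0 + ε * ‖x - x₀‖) →
      √(f x₀) ≤ α

theorem posSet_mono (hle : ∀ x ∉ D, w x ≤ v x) : posSet D w ⊆ posSet D v :=
  fun x hx => ⟨hx.1, hx.2.trans_le (hle x hx.1)⟩

theorem SubFBAt.of_le (hw : SubFBAt D f w x) (hle : ∀ x ∉ D, w x ≤ v x) : SubFBAt D f v x := by
  intro y ρ hρ hdisj hx α hα
  refine hw y ρ hρ (hdisj.mono_right (posSet_mono hle)) hx α fun ε hε => ?_
  filter_upwards [hα ε hε, self_mem_nhdsWithin] with z hz hzD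
  exact (hle z hzD).trans hz

theorem eventually_compl_of_notMem_closure (hx : x ∉ closure D) : ∀ᶠ y in 𝓝 x, y ∉ D := by
  filter_upwards [isClosed_closure.isOpen_compl.mem_nhds hx] with y hy
  exact fun h => hy (subset_closure h)

theorem subFBAt_of_slope {L : Plane → ℝ} {e : Plane} {s : ℝ} (hx : x ∉ closure D)
    (hle : L ≤ᶠ[𝓝 x] v) (hL0 : L x = 0) (he : ‖e‖ = 1) (hs : 0 < s) (hfs : √(f x) ≤ s)
    (hd : HasDerivAt (fun t : ℝ => L (x + t • e)) s 0) : SubFBAt D f v x := by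
  intro y ρ hρ _ hxy α hα
  by_contra! hlt
  set β := max α 0 with hβ
  have hβs : β < s := max_lt (hlt.trans_le hfs) hs
  set ε := (s - β) / 3 with hε
  have hε0 : 0 < ε := by rw [hε]; linarith
  have hline : Tendsto (fun t : ℝ => x + t • e) (𝓝[>] 0) (𝓝 x) := by
    have : Continuous fun t : ℝ => x + t • e := by fun_prop
    have h := this.tendsto 0
    simp only [zero_smul, add_zero] at h
    exact h.mono_left nhdsWithin_le_nhds
  have hline' : Tendsto (fun t : ℝ => x + t • e) (𝓝[>] 0) (𝓝[Dᶜ] x) :=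
    tendsto_nhdsWithin_iff.2 ⟨hline, hline.eventually (eventually_compl_of_notMem_closure hx)⟩
  have hslope : ∀ᶠ t in 𝓝[>] (0 : ℝ), (s - ε) * t < L (x + t • e) := by
    have h1 := (hd.tendsto_slope_zero_right).eventually (lt_mem_nhds (show s - ε < s by linarith))
    filter_upwards [h1, self_mem_nhdsWithin] with t ht ht0
    have ht0' : 0 < t := ht0
    simp only [zero_add, zero_smul, add_zero, hL0, sub_zero, smul_eq_mul] at ht
    rw [inv_mul_eq_div, lt_div_iff₀ ht0'] at ht
    exact ht
  obtain ⟨t, ht1, ht2, ht3, ht0⟩ := (hslope.and ((hline'.eventually (hα ε hε0)).and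
    ((hline.eventually hle).and self_mem_nhdsWithin))).exists
  have ht0' : 0 < t := ht0
  simp only [add_sub_cancel_left] at ht2
  have hν : ‖ρ⁻¹ • (x - y)‖ = 1 := by
    rw [mem_sphere, dist_eq_norm] at hxy
    rw [norm_smul, hxy, norm_inv, Real.norm_of_nonneg hρ.le, inv_mul_cancel₀ hρ.ne']
  have hin : max ⟪t • e, ρ⁻¹ • (x - y)⟫ 0 ≤ t := by
    refine max_le ?_ ht0'.le
    refine (real_inner_le_norm _ _).trans ?_
    rw [hν, norm_smul, he, Real.norm_of_nonneg ht0'.le]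
    simp
  have hin0 : 0 ≤ max ⟪t • e, ρ⁻¹ • (x - y)⟫ 0 := le_max_right _ _
  have h5 : α * max ⟪t • e, ρ⁻¹ • (x - y)⟫ 0 ≤ β * t :=
    (mul_le_mul_of_nonneg_right (le_max_left α 0) hin0).trans
      (mul_le_mul_of_nonneg_left hin (le_max_right α 0))
  have h6 : ‖t • e‖ = t := by rw [norm_smul, he, Real.norm_of_nonneg ht0'.le, mul_one]
  rw [h6] at ht2
  have h7 : (s - ε) * t < β * t + ε * t := by linarith
  have h8 : s - ε < β + ε := by nlinarith
  rw [hε] at h8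
  linarith

theorem eventually_pos_of_pos (hc : ContinuousOn v Dᶜ) (hx : x ∉ D) {c : ℝ} (hpos : c < v x) :
    ∀ᶠ y in 𝓝[Dᶜ] x, c < v y :=
  (hc x hx).eventually (lt_mem_nhds hpos)

theorem nonpos_of_mem_freeBoundary (hc : 0 < v x → ∀ᶠ y in 𝓝[Dᶜ] x, 0 < v y)
    (hx : x ∈ freeBoundary D v) : v x ≤ 0 := by
  by_contra! hpos
  have h2 := mem_closure_iff_frequently.1 hx.2
  have h1 := eventually_nhdsWithin_iff.1 (hc hpos)
  obtain ⟨y, hy1, hy2⟩ := (h2.and_eventually h1).exists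
  exact hy1.2 ⟨hy1.1, hy2 hy1.1⟩

theorem mem_freeBoundary_of_nonpos (hx : x ∉ D) (hv : v x ≤ 0) (hcl : x ∈ closure (posSet D v)) :
    x ∈ freeBoundary D v :=
  ⟨⟨hx, hcl⟩, subset_closure ⟨hx, fun h => absurd h.2 (not_lt.2 hv)⟩⟩

theorem isClosed_freeBoundary (hD : IsOpen D) : IsClosed (freeBoundary D v) :=
  (hD.isClosed_compl.inter isClosed_closure).inter isClosed_closure

theorem IsSubsolution.viscSubAt (hv : IsSubsolution D f g v) (hx : x ∉ closure D) (hpos : 0 < v x) :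
    ViscSubAt v x :=
  hv.subharmonic x ⟨fun h => hx (subset_closure h), hpos⟩ hx

/-- At a zero of `v` in the closure of `Ω(w)`, with `w ≤ v` a subsolution, the free boundary
condition is inherited from `w`. -/
theorem IsSubsolution.subFBAt_of_le (hw : IsSubsolution D f g w) (hle : ∀ x ∉ D, w x ≤ v x)
    (hx : x ∉ D) (hv0 : v x = 0) (hcl : x ∈ closure (posSet D w)) : SubFBAt D f v x :=
  SubFBAt.of_le (w := w) (hw.free_boundary x
    (mem_freeBoundary_of_nonpos hx ((hle x hx).trans hv0.le) hcl)) hle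

theorem isSubsolution_zero (hg : ∀ x ∈ frontier D, 0 < g x) : IsSubsolution D f g fun _ => 0 where
  continuousOn := continuousOn_const
  nonneg _ _ := le_rfl
  subharmonic x hx := absurd hx.2 (lt_irrefl _)
  le_boundary x hx := (hg x hx).le
  free_boundary x hx := by
    have : posSet D (fun _ => (0 : ℝ)) = ∅ := by ext; simp [posSet]
    simp [freeBoundary, this] at hx

theorem IsSubsolution.sup (hv : IsSubsolution D f g v) (hw : IsSubsolution D f g w) :
    IsSubsolution D f g fun x => max (v x) (w x) := by
  have hc : ContinuousOn (fun x => max (v x) (w x)) Dᶜ :=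
    ContinuousOn.sup hv.continuousOn hw.continuousOn
  refine ⟨hc, fun x hx => le_max_of_le_left (hv.nonneg x hx), ?_,
    fun x hx => max_le (hv.le_boundary x hx) (hw.le_boundary x hx), ?_⟩
  · intro x hx hxD
    rcases le_total (w x) (v x) with hle | hle
    · refine ViscSubAt.of_le (w := v) (hv.viscSubAt hxD ?_)
        (Eventually.of_forall fun y => le_max_left _ _) (max_eq_left hle).symm
      simpa [max_eq_left hle] using hx.2
    · refine ViscSubAt.of_le (w := w) (hw.viscSubAt hxD ?_)
        (Eventually.of_forall fun y => le_max_right _ _) (max_eq_right hle).symm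
      simpa [max_eq_right hle] using hx.2
  · intro x hx
    have h0 : max (v x) (w x) = 0 :=
      le_antisymm (nonpos_of_mem_freeBoundary (eventually_pos_of_pos hc hx.1.1) hx)
        (le_max_of_le_left (hv.nonneg x hx.1.1))
    have hsub : posSet D (fun x => max (v x) (w x)) ⊆ posSet D v ∪ posSet D w := by
      rintro y ⟨hyD, hy⟩
      rcases lt_max_iff.1 hy with hy | hy
      · exact Or.inl ⟨hyD, hy⟩
      · exact Or.inr ⟨hyD, hy⟩
    have hcl := closure_mono hsub hx.1.2
    rw [closure_union] at hcl
    rcases hcl with hcl | hcl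
    · exact hv.subFBAt_of_le (fun _ _ => le_max_left _ _) hx.1.1 h0 hcl
    · exact hw.subFBAt_of_le (fun _ _ => le_max_right _ _) hx.1.1 h0 hcl

/-- The competitors in the definition of the largest subsolution. -/
def Admissible (D : Set Plane) (f g h v : Plane → ℝ) : Prop :=
  IsSubsolution D f g v ∧ ∀ y ∉ D, v y ≤ h y

theorem Admissible.sup (hv : Admissible D f g h v) (hw : Admissible D f g h w) :
    Admissible D f g h fun x => max (v x) (w x) :=
  ⟨hv.1.sup hw.1, fun y hy => max_le (hv.2 y hy) (hw.2 y hy)⟩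

theorem Admissible.le_largest (hv : Admissible D f g h v) (hx : x ∉ D) :
    v x ≤ largestSubsolution D f g h x := by
  refine le_csSup ⟨h x, ?_⟩ ⟨v, hv.1, hv.2, rfl⟩
  rintro t ⟨w, _, hw, rfl⟩
  exact hw x hx

/-- The properties of the upper barrier that Perron's method uses. -/
structure IsUpperBarrier (D : Set Plane) (h : Plane → ℝ) : Prop where
  nonneg : ∀ x, 0 ≤ h x
  harmonic : ∀ x ∉ D, 0 < h x → HarmonicAt h x
  support : ∃ (c : Plane) (R : ℝ), ∀ x, R ≤ dist x c → h x = 0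

theorem admissible_zero (hg : ∀ x ∈ frontier D, 0 < g x) (hh : IsUpperBarrier D h) :
    Admissible D f g h fun _ => 0 :=
  ⟨isSubsolution_zero hg, fun y _ => hh.nonneg y⟩

theorem exists_admissible_lt (hg : ∀ x ∈ frontier D, 0 < g x) (hh : IsUpperBarrier D h) {c : ℝ}
    (hc : c < largestSubsolution D f g h x) : ∃ v, Admissible D f g h v ∧ c < v x := by
  have hne : {t : ℝ | ∃ v : Plane → ℝ, IsSubsolution D f g v ∧ (∀ y ∉ D, v y ≤ h y) ∧
      v x = t}.Nonempty :=
    ⟨0, fun _ => 0, (admissible_zero hg hh).1, (admissible_zero (f := f) hg hh).2, rfl⟩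
  obtain ⟨t, ⟨v, h1, h2, rfl⟩, hlt⟩ := exists_lt_of_lt_csSup hne hc
  exact ⟨v, ⟨h1, h2⟩, hlt⟩

theorem largest_nonneg (hg : ∀ x ∈ frontier D, 0 < g x) (hh : IsUpperBarrier D h) (hx : x ∉ D) :
    0 ≤ largestSubsolution D f g h x :=
  Admissible.le_largest (admissible_zero hg hh) hx

theorem largest_le_of_forall (hg : ∀ x ∈ frontier D, 0 < g x) (hh : IsUpperBarrier D h) {c : ℝ}
    (hc : ∀ v, Admissible D f g h v → v x ≤ c) : largestSubsolution D f g h x ≤ c := by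
  by_contra! hlt
  obtain ⟨v, hv, hvx⟩ := exists_admissible_lt hg hh hlt
  linarith [hc v hv]

theorem largest_le (hg : ∀ x ∈ frontier D, 0 < g x) (hh : IsUpperBarrier D h) (hx : x ∉ D) :
    largestSubsolution D f g h x ≤ h x :=
  largest_le_of_forall hg hh fun _ hv => hv.2 x hx

theorem eventually_lt_largest (hg : ∀ x ∈ frontier D, 0 < g x) (hh : IsUpperBarrier D h)
    (hx : x ∉ D) {c : ℝ} (hc : c < largestSubsolution D f g h x) :
    ∀ᶠ y in 𝓝[Dᶜ] x, c < largestSubsolution D f g h y := by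
  obtain ⟨v, hv, hvx⟩ := exists_admissible_lt hg hh hc
  filter_upwards [eventually_pos_of_pos hv.1.continuousOn hx hvx, self_mem_nhdsWithin] with y hy hyD
  exact hy.trans_le (hv.le_largest hyD)

theorem largest_eq_zero_of_mem_freeBoundary (hg : ∀ x ∈ frontier D, 0 < g x)
    (hh : IsUpperBarrier D h) (hx : x ∈ freeBoundary D (largestSubsolution D f g h)) :
    largestSubsolution D f g h x = 0 :=
  le_antisymm (nonpos_of_mem_freeBoundary (eventually_lt_largest hg hh hx.1.1) hx)
    (largest_nonneg hg hh hx.1.1)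

/-- Strict lower bounds of the largest subsolution on compact sets are attained by a competitor. -/
theorem exists_admissible_lt_on_compact (hg : ∀ x ∈ frontier D, 0 < g x)
    (hh : IsUpperBarrier D h) {K : Set Plane} (hK : IsCompact K) (hKD : K ⊆ Dᶜ) {c : ℝ}
    (hc : ∀ x ∈ K, c < largestSubsolution D f g h x) :
    ∃ v, Admissible D f g h v ∧ ∀ x ∈ K, c < v x := by
  refine hK.induction_on (p := fun s => ∃ v, Admissible D f g h v ∧ ∀ x ∈ s, c < v x) ?_ ?_ ?_ ?_
  · exact ⟨_, admissible_zero hg hh, by simp⟩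
  · rintro s t hst ⟨v, hv, h1⟩
    exact ⟨v, hv, fun x hx => h1 x (hst hx)⟩
  · rintro s t ⟨v, hv, h1⟩ ⟨w, hw, h2⟩
    refine ⟨_, hv.sup hw, ?_⟩
    rintro x (hx | hx)
    · exact lt_max_of_lt_left (h1 x hx)
    · exact lt_max_of_lt_right (h2 x hx)
  · intro x hx
    obtain ⟨v, hv, hvx⟩ := exists_admissible_lt hg hh (hc x hx)
    refine ⟨_, nhdsWithin_mono x hKD (eventually_pos_of_pos hv.1.continuousOn (hKD hx) hvx), v, hv,
      fun y hy => hy⟩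

open Classical in
/-- Harmonic replacement in a closed disc on which a competitor is positive. -/
theorem Admissible.exists_harmonic_replacement (hD : IsOpen D) (hh : IsUpperBarrier D h)
    (hv : Admissible D f g h v) {c : Plane} {R : ℝ} (hR : 0 < R)
    (hball : closedBall c R ⊆ (closure D)ᶜ) (hpos : ∀ x ∈ closedBall c R, 0 < v x) :
    ∃ w, Admissible D f g h w ∧ (∀ x ∉ D, v x ≤ w x) ∧ HarmonicOnNhd w (ball c R) := by
  have hballD : closedBall c R ⊆ Dᶜ := fun x hx h => hball hx (subset_closure h)
  have hvc : ContinuousOn v (closedBall c R) := hv.1.continuousOn.mono hballD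
  obtain ⟨H, hHc, hHh, hHs⟩ := exists_harmonic_extension hR (hvc.mono sphere_subset_closedBall)
  have hclos : closure (ball c R) = closedBall c R := closure_ball c hR.ne'
  have hfr : frontier (ball c R) = sphere c R := frontier_ball c hR.ne'
  have hvH : ∀ x ∈ closedBall c R, v x ≤ H x := by
    have := le_of_viscSubAt (isOpen_ball (x := c) (ε := R)) isBounded_ball (v := v) (H := H)
      (by rwa [hclos]) (by rwa [hclos]) hHh
      (fun x hx _ => hv.1.viscSubAt (hball (ball_subset_closedBall hx))
        (hpos x (ball_subset_closedBall hx)))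
      (fun x hx => by rw [hfr] at hx; exact (hHs hx).ge)
    rwa [hclos] at this
  have hhharm : HarmonicOnNhd h (closedBall c R) := fun x hx =>
    hh.harmonic x (hballD hx) ((hpos x hx).trans_le (hv.2 x (hballD hx)))
  have hHh' : ∀ x ∈ closedBall c R, H x ≤ h x := by
    have := le_of_viscSubAt (isOpen_ball (x := c) (ε := R)) isBounded_ball (v := H) (H := h)
      (by rwa [hclos]) (by rw [hclos]; exact hhharm.continuousOn)
      (hhharm.mono ball_subset_closedBall)
      (fun x hx _ => viscSubAt_of_harmonicAt (hHh x hx))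
      (fun x hx => by
        rw [hfr] at hx
        rw [hHs hx]
        exact hv.2 x (hballD (sphere_subset_closedBall hx)))
    rwa [hclos] at this
  set w : Plane → ℝ := fun x => if x ∈ ball c R then H x else v x with hw
  have hwH : EqOn w H (closedBall c R) := by
    intro x hx
    by_cases hxb : x ∈ ball c R
    · simp only [hw, if_pos hxb]
    · have hxs : x ∈ sphere c R := le_antisymm hx (not_lt.1 hxb)
      simp only [hw, if_neg hxb, hHs hxs]
  have hwv : EqOn w v (ball c R)ᶜ := fun x hx => if_neg hx
  have hvw : ∀ x, v x ≤ w x := by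
    intro x
    by_cases hxb : x ∈ ball c R
    · rw [hwH (ball_subset_closedBall hxb)]
      exact hvH x (ball_subset_closedBall hxb)
    · exact (hwv hxb).ge
  have hwc : ContinuousOn w Dᶜ := by
    have h1 : ContinuousOn w (closedBall c R) := hHc.congr hwH
    have h2 : ContinuousOn w (Dᶜ ∩ (ball c R)ᶜ) :=
      (hv.1.continuousOn.mono inter_subset_left).congr (hwv.mono inter_subset_right)
    have h3 := h1.union_of_isClosed h2 isClosed_closedBall
      (hD.isClosed_compl.inter isOpen_ball.isClosed_compl)
    refine h3.mono fun x hx => ?_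
    by_cases hxb : x ∈ ball c R
    · exact Or.inl (ball_subset_closedBall hxb)
    · exact Or.inr ⟨hx, hxb⟩
  have hwpos : posSet D w ⊆ posSet D v := by
    rintro x ⟨hxD, hx⟩
    by_cases hxb : x ∈ ball c R
    · exact ⟨hxD, hpos x (ball_subset_closedBall hxb)⟩
    · exact ⟨hxD, by rwa [hwv hxb] at hx⟩
  have hnhds : ∀ x ∈ ball c R, w =ᶠ[𝓝 x] H := fun x hx =>
    (hwH.mono ball_subset_closedBall).eventuallyEq_of_mem (isOpen_ball.mem_nhds hx)
  have hharm : HarmonicOnNhd w (ball c R) := fun x hx =>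
    (harmonicAt_congr_nhds (hnhds x hx)).2 (hHh x hx)
  refine ⟨w, ⟨⟨hwc, fun x hx => (hv.1.nonneg x hx).trans (hvw x), ?_, ?_, ?_⟩, ?_⟩,
    fun x _ => hvw x, hharm⟩
  · intro x hx hxD
    by_cases hxb : x ∈ ball c R
    · exact viscSubAt_of_harmonicAt (hharm x hxb)
    · exact (hv.1.viscSubAt hxD (hwpos hx).2).of_le (Eventually.of_forall hvw) (hwv hxb).symm
  · intro x hx
    have hxb : x ∉ ball c R := fun h => hball (ball_subset_closedBall h) hx.1
    rw [hwv hxb]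
    exact hv.1.le_boundary x hx
  · intro x hx
    have h0 : w x = 0 :=
      le_antisymm (nonpos_of_mem_freeBoundary (eventually_pos_of_pos hwc hx.1.1) hx)
        ((hv.1.nonneg x hx.1.1).trans (hvw x))
    exact hv.1.subFBAt_of_le (fun y _ => hvw y) hx.1.1 h0 (closure_mono hwpos hx.1.2)
  · intro y hy
    by_cases hyb : y ∈ ball c R
    · rw [hwH (ball_subset_closedBall hyb)]
      exact hHh' y (ball_subset_closedBall hyb)
    · rw [hwv hyb]
      exact hv.2 y hy

/-- Perron's method: the largest subsolution is harmonic where it is positive, away from `D`. -/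
theorem harmonicOnNhd_largest_of_closedBall (hD : IsOpen D) (hg : ∀ x ∈ frontier D, 0 < g x)
    (hh : IsUpperBarrier D h) {c : Plane} {R : ℝ} (hR : 0 < R)
    (hball : closedBall c R ⊆ (closure D)ᶜ)
    (hpos : ∀ x ∈ closedBall c R, 0 < largestSubsolution D f g h x) :
    HarmonicOnNhd (largestSubsolution D f g h) (ball c R) := by
  set u := largestSubsolution D f g h with hu
  have hballD : closedBall c R ⊆ Dᶜ := fun x hx h => hball hx (subset_closure h)
  obtain ⟨v₀, hv₀, hv₀pos⟩ := exists_admissible_lt_on_compact hg hh (isCompact_closedBall c R)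
    hballD hpos
  have hchoose : ∀ n : ℕ, ∃ v, Admissible D f g h v ∧
      (TopologicalSpace.denseSeq Plane n.unpair.1 ∉ D →
        u (TopologicalSpace.denseSeq Plane n.unpair.1) - 1 / ((n.unpair.2 : ℝ) + 1) <
          v (TopologicalSpace.denseSeq Plane n.unpair.1)) := by
    intro n
    have hlt : u (TopologicalSpace.denseSeq Plane n.unpair.1) - 1 / ((n.unpair.2 : ℝ) + 1) <
        u (TopologicalSpace.denseSeq Plane n.unpair.1) := by
      have : (0 : ℝ) < 1 / ((n.unpair.2 : ℝ) + 1) := by positivity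
      linarith
    obtain ⟨v, hv, hvx⟩ := exists_admissible_lt hg hh hlt
    exact ⟨v, hv, fun _ => hvx⟩
  choose a ha haq using hchoose
  have hstep : ∀ b : {v : Plane → ℝ // Admissible D f g h v ∧ ∀ x ∈ closedBall c R, 0 < v x},
      ∀ n : ℕ, ∃ b' : {v : Plane → ℝ // Admissible D f g h v ∧ ∀ x ∈ closedBall c R, 0 < v x},
        (∀ x ∉ D, max (b.1 x) (a n x) ≤ b'.1 x) ∧ HarmonicOnNhd b'.1 (ball c R) := by
    intro b n
    obtain ⟨w, hw1, hw2, hw3⟩ := (b.2.1.sup (ha n)).exists_harmonic_replacement hD hh hR hball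
      (fun x hx => lt_max_of_lt_left (b.2.2 x hx))
    exact ⟨⟨w, hw1, fun x hx => (lt_max_of_lt_left (b.2.2 x hx)).trans_le
      (hw2 x (hballD hx))⟩, hw2, hw3⟩
  choose F hF1 hF2 using hstep
  set b : ℕ → {v : Plane → ℝ // Admissible D f g h v ∧ ∀ x ∈ closedBall c R, 0 < v x} :=
    fun n => Nat.rec ⟨v₀, hv₀, hv₀pos⟩ (fun n b => F b n) n with hb
  have hbs : ∀ n, b (n + 1) = F (b n) n := fun n => rfl
  have hmono : ∀ x ∉ D, Monotone fun n => (b n).1 x := fun x hx =>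
    monotone_nat_of_le_succ fun n => by
      rw [hbs]
      exact (le_max_left _ _).trans (hF1 (b n) n x hx)
  have hbu : ∀ n, ∀ x ∉ D, (b n).1 x ≤ u x := fun n x hx => (b n).2.1.le_largest hx
  set V : Plane → ℝ := fun x => ⨆ n, (b n).1 x with hV
  have hVlim : ∀ x ∉ D, Tendsto (fun n => (b n).1 x) atTop (𝓝 (V x)) := fun x hx =>
    tendsto_atTop_ciSup (hmono x hx) ⟨u x, by rintro _ ⟨n, rfl⟩; exact hbu n x hx⟩
  obtain ⟨M, hM⟩ : ∃ M, ∀ x ∈ closedBall c R, h x ≤ M := by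
    have hhharm : HarmonicOnNhd h (closedBall c R) := fun x hx =>
      hh.harmonic x (hballD hx) ((hpos x hx).trans_le (largest_le hg hh (hballD hx)))
    obtain ⟨M, hM⟩ := (isCompact_closedBall c R).exists_bound_of_continuousOn hhharm.continuousOn
    exact ⟨M, fun x hx => (le_abs_self _).trans (hM x hx)⟩
  have hVharm : HarmonicOnNhd V (ball c R) := by
    refine harmonicOnNhd_of_tendsto (M := M) (H := fun n => (b (n + 1)).1)
      (fun n => by rw [hbs]; exact hF2 _ _) ?_ ?_
    · intro n z hz
      have hz' := ball_subset_closedBall hz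
      rw [abs_of_pos ((b (n + 1)).2.2 z hz')]
      exact ((b (n + 1)).2.1.2 z (hballD hz')).trans (hM z hz')
    · intro z hz
      exact (hVlim z (hballD (ball_subset_closedBall hz))).comp (tendsto_add_atTop_nat 1)
  have hVu : ∀ x ∉ D, V x ≤ u x := fun x hx =>
    le_of_tendsto (hVlim x hx) (Eventually.of_forall fun n => hbu n x hx)
  have hdense : ∀ k, TopologicalSpace.denseSeq Plane k ∉ D →
      u (TopologicalSpace.denseSeq Plane k) ≤ V (TopologicalSpace.denseSeq Plane k) := by
    intro k hk
    refine le_of_forall_pos_lt_add fun ε hε => ?_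
    obtain ⟨m, hm⟩ := exists_nat_one_div_lt hε
    have h1 := haq (Nat.pair k m)
    simp only [Nat.unpair_pair] at h1
    have h2 := hF1 (b (Nat.pair k m)) (Nat.pair k m) _ hk
    rw [← hbs] at h2
    have h3 := (hmono _ hk).ge_of_tendsto (hVlim _ hk) (Nat.pair k m + 1)
    have h4 := le_max_right ((b (Nat.pair k m)).1 (TopologicalSpace.denseSeq Plane k))
      (a (Nat.pair k m) (TopologicalSpace.denseSeq Plane k))
    have h5 := h1 hk
    linarith
  have huV : EqOn u V (ball c R) := by
    intro x hx
    have hxD : x ∉ D := hballD (ball_subset_closedBall hx)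
    refine le_antisymm ?_ (hVu x hxD)
    refine largest_le_of_forall hg hh fun w hw => ?_
    by_contra! hlt
    have hwc : ContinuousAt w x := (hw.1.continuousOn x hxD).continuousAt
      (eventually_compl_of_notMem_closure (hball (ball_subset_closedBall hx)))
    have hev : ∀ᶠ y in 𝓝 x, V y < w y ∧ y ∈ ball c R :=
      ((hVharm x hx).1.continuousAt.eventually_lt hwc hlt).and (isOpen_ball.mem_nhds hx)
    obtain ⟨y, ⟨k, rfl⟩, hy1, hy2⟩ :=
      (TopologicalSpace.denseRange_denseSeq Plane).inter_nhds_nonempty hev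
    have hyD : TopologicalSpace.denseSeq Plane k ∉ D := hballD (ball_subset_closedBall hy2)
    linarith [hdense k hyD, hw.le_largest hyD]
  exact fun x hx => (harmonicAt_congr_nhds
    (huV.eventuallyEq_of_mem (isOpen_ball.mem_nhds hx))).2 (hVharm x hx)

theorem harmonicAt_largest (hD : IsOpen D) (hg : ∀ x ∈ frontier D, 0 < g x)
    (hh : IsUpperBarrier D h) (hx : x ∉ closure D) (hpos : 0 < largestSubsolution D f g h x) :
    HarmonicAt (largestSubsolution D f g h) x := by
  have hxD : x ∉ D := fun h => hx (subset_closure h)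
  have h1 := eventually_nhdsWithin_iff.1 (eventually_lt_largest hg hh hxD hpos)
  have h2 : ∀ᶠ y in 𝓝 x, y ∉ closure D := isClosed_closure.isOpen_compl.mem_nhds hx
  obtain ⟨R, hR, hsub⟩ := Metric.nhds_basis_closedBall.eventually_iff.1 (h1.and h2)
  exact harmonicOnNhd_largest_of_closedBall hD hg hh hR (fun y hy => (hsub hy).2)
    (fun y hy => (hsub hy).1 fun h => (hsub hy).2 (subset_closure h)) x (mem_ball_self hR)

/-- The largest subsolution is bounded by the boundary data. -/
theorem largest_le_of_boundary_le (hD : IsOpen D) (hg : ∀ x ∈ frontier D, 0 < g x) (hh : IsUpperBarrier D h)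
    {M : ℝ} (hM0 : 0 ≤ M) (hM : ∀ x ∈ frontier D, g x ≤ M) (hx : x ∉ D) :
    largestSubsolution D f g h x ≤ M := by
  refine largest_le_of_forall hg hh fun v hv => ?_
  obtain ⟨c, R, hR⟩ := hh.support
  set U := (closure D)ᶜ ∩ ball c R with hU
  have hopen : IsOpen U := isClosed_closure.isOpen_compl.inter isOpen_ball
  have hclD : closure U ⊆ Dᶜ :=
    closure_minimal (fun y hy h => hy.1 (subset_closure h)) hD.isClosed_compl
  have hout : ∀ y ∉ D, y ∉ U → v y ≤ M := by
    intro y hyD hyU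
    by_cases hyc : y ∈ closure D
    · have hyf : y ∈ frontier D := ⟨hyc, fun h => hyD (interior_subset h)⟩
      exact (hv.1.le_boundary y hyf).trans (hM y hyf)
    · have hyb : R ≤ dist y c := by
        by_contra! hlt
        exact hyU ⟨hyc, hlt⟩
      have := hv.2 y hyD
      rw [hR y hyb] at this
      linarith
  by_cases hxU : x ∈ U
  · refine le_of_viscSubAt hopen (isBounded_ball.subset inter_subset_right) (v := v)
      (H := fun _ => M) (hv.1.continuousOn.mono hclD) continuousOn_const (harmonicOnNhd_const M)
      (fun y hy hlt => hv.1.viscSubAt hy.1 (hM0.trans_lt hlt)) (fun y hy => ?_) x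
      (subset_closure hxU)
    exact hout y (hclD hy.1) fun h => hy.2 (by rwa [hopen.interior_eq])
  · exact hout x hx hxU

end FreeBoundary

section SqrtBarrier

/-- `(z - b) / (z - a)` has an analytic square root outside a compact subset of any connected open
set containing `a` and `b`. -/
theorem exists_sqrt_branch {U : Set ℂ} (hU : IsOpen U) (hc : IsPreconnected U) {a b : ℂ}
    (ha : a ∈ U) (hb : b ∈ U) :
    ∃ (K : Set ℂ) (q : ℂ → ℂ), IsCompact K ∧ K ⊆ U ∧
      (∀ z ∉ K, AnalyticAt ℂ q z ∧ q z ^ 2 * (z - a) = z - b) ∧ Tendsto q (cocompact ℂ) (𝓝 1) := by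
  have hlocal : ∀ x y : ℂ, closedBall x (dist y x) ⊆ U →
      ∃ (K : Set ℂ) (q : ℂ → ℂ), IsCompact K ∧ K ⊆ U ∧
        (∀ z ∉ K, AnalyticAt ℂ q z ∧ q z ^ 2 * (z - x) = z - y) ∧
        Tendsto q (cocompact ℂ) (𝓝 1) := by
    intro x y hsub
    have hform : ∀ z, z ≠ x → 1 + (x - y) / (z - x) = (z - y) / (z - x) := fun z hz => by
      have : z - x ≠ 0 := sub_ne_zero.2 hz
      field_simp
      ring
    refine ⟨closedBall x (dist y x), fun z => (1 + (x - y) / (z - x)) ^ (1 / 2 : ℂ),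
      isCompact_closedBall _ _, hsub, ?_, ?_⟩
    · intro z hz
      have hz' : dist y x < dist z x := by simpa using hz
      have hzx : z ≠ x := by
        rintro rfl
        simp only [dist_self] at hz'
        exact absurd hz' (not_lt.2 dist_nonneg)
      have hzx0 : z - x ≠ 0 := sub_ne_zero.2 hzx
      have hslit : 1 + (x - y) / (z - x) ∈ Complex.slitPlane := by
        apply Complex.mem_slitPlane_of_norm_lt_one
        rw [norm_div, div_lt_one (norm_pos_iff.2 hzx0), ← dist_eq_norm, ← dist_eq_norm, dist_comm]
        exact hz'
      refine ⟨?_, ?_⟩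
      · refine AnalyticAt.cpow ?_ analyticAt_const hslit
        have : AnalyticAt ℂ (fun z : ℂ => z - x) z := by fun_prop
        exact analyticAt_const.add (analyticAt_const.div this hzx0)
      · rw [← Complex.cpow_nat_mul]
        norm_num
        rw [hform z hzx, div_mul_cancel₀ _ hzx0]
    · have h1 : Tendsto (fun z : ℂ => 1 + (x - y) / (z - x)) (cocompact ℂ) (𝓝 1) := by
        have h2 : Tendsto (fun z : ℂ => (z - x)⁻¹) (cocompact ℂ) (𝓝 0) := by
          rw [← Metric.cobounded_eq_cocompact]
          exact (tendsto_inv₀_cobounded (α := ℂ)).comp (tendsto_sub_const_cobounded x)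
        simpa [div_eq_mul_inv] using (h2.const_mul (x - y)).const_add 1
      have h3 : ContinuousAt (fun w : ℂ => w ^ (1 / 2 : ℂ)) 1 :=
        continuousAt_cpow_const (by simp [Complex.one_mem_slitPlane])
      have h4 := h3.tendsto.comp h1
      rw [Complex.one_cpow] at h4
      exact h4
  refine hc.induction₂' (P := fun x y => ∃ (K : Set ℂ) (q : ℂ → ℂ), IsCompact K ∧ K ⊆ U ∧
      (∀ z ∉ K, AnalyticAt ℂ q z ∧ q z ^ 2 * (z - x) = z - y) ∧
      Tendsto q (cocompact ℂ) (𝓝 1)) ?_ ?_ ha hb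
  · intro x hx
    obtain ⟨η, hη, hsub⟩ := Metric.isOpen_iff.1 hU x hx
    filter_upwards [nhdsWithin_le_nhds (ball_mem_nhds x (half_pos hη))] with y hy
    have hy' : dist y x < η / 2 := hy
    refine ⟨hlocal x y fun z hz => hsub ?_, hlocal y x fun z hz => hsub ?_⟩
    · have : dist z x ≤ dist y x := hz
      rw [mem_ball]
      linarith
    · have : dist z y ≤ dist x y := hz
      rw [dist_comm x y] at this
      rw [mem_ball]
      linarith [dist_triangle z y x]
  · rintro x y z _ _ _ ⟨K₁, q₁, hK₁, hs₁, h₁, ht₁⟩ ⟨K₂, q₂, hK₂, hs₂, h₂, ht₂⟩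
    refine ⟨K₁ ∪ K₂, fun w => q₁ w * q₂ w, hK₁.union hK₂, union_subset hs₁ hs₂, ?_, ?_⟩
    · intro w hw
      have hw₁ := h₁ w fun h => hw (Or.inl h)
      have hw₂ := h₂ w fun h => hw (Or.inr h)
      refine ⟨hw₁.1.mul hw₂.1, ?_⟩
      rw [← hw₂.2, ← hw₁.2]
      ring
    · simpa using ht₁.mul ht₂

theorem hasDerivAt_log_norm {γ : ℝ → ℂ} {k t : ℝ} (hγ : HasDerivAt γ (k • γ t) t) (h0 : γ t ≠ 0) :
    HasDerivAt (fun s => Real.log ‖γ s‖) k t := by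
  have h1 := hγ.norm_sq
  have hpos : 0 < ‖γ t‖ := norm_pos_iff.2 h0
  have h2 := (h1.log (by positivity)).div_const 2
  have h3 : (fun s => Real.log ‖γ s‖) = fun s => Real.log (‖γ s‖ ^ 2) / 2 := by
    ext s
    rw [Real.log_pow]
    push_cast
    ring
  rw [h3]
  have h4 : 2 * ⟪γ t, k • γ t⟫ / ‖γ t‖ ^ 2 / 2 = k := by
    rw [real_inner_smul_right, real_inner_self_eq_norm_sq]
    field_simp
  rwa [h4] at h2

theorem exists_far_point_in_component {D : Set ℂ} (hD : IsOpen D) (hc : IsPreconnected D) {a : ℂ}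
    (ha : a ∈ D) {ε : ℝ} (hε : 0 < ε) (hnot : ¬ D ⊆ ball a (ε / 2)) :
    ∃ b ∈ connectedComponentIn (D ∩ ball a ε) a, ε / 2 ≤ dist b a := by
  by_contra! hcon
  set U := connectedComponentIn (D ∩ ball a ε) a with hUdef
  have haU : a ∈ D ∩ ball a ε := ⟨ha, mem_ball_self hε⟩
  have hUo : IsOpen U := (hD.inter isOpen_ball).connectedComponentIn
  have hUsub : U ⊆ ball a (ε / 2) := fun b hb => hcon b hb
  have hclos : closure U ⊆ closedBall a (ε / 2) :=
    closure_minimal (hUsub.trans ball_subset_closedBall) isClosed_closedBall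
  refine hnot (Subset.trans (hc.subset_of_closure_inter_subset hUo
    ⟨a, ha, mem_connectedComponentIn haU⟩ ?_) hUsub)
  have hpc : IsPreconnected (closure U ∩ D) :=
    isPreconnected_connectedComponentIn.subset_closure
      (fun x hx => ⟨subset_closure hx, (connectedComponentIn_subset _ _ hx).1⟩) inter_subset_left
  refine hpc.subset_connectedComponentIn ⟨subset_closure (mem_connectedComponentIn haU), ha⟩ ?_
  intro x hx
  exact ⟨hx.2, closedBall_subset_ball (by linarith) (hclos hx.1)⟩

/-- Logarithmic barrier: a function harmonic off `D`, bounded above there, positive near `a`,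
negative far from `a`, and steep in between. -/
theorem exists_log_barrier_complex {D : Set ℂ} (hD : IsOpen D) (hc : IsPreconnected D) {a : ℂ}
    (ha : a ∈ D) {ε : ℝ} (hε : 0 < ε) (hnot : ¬ D ⊆ ball a (ε / 2)) :
    ∃ L : ℂ → ℝ, (∀ z ∉ D, HarmonicAt L z) ∧ (∀ z ∉ D, L z ≤ 8) ∧
      (∀ z ∉ D, dist z a < 2 * ε → 0 < L z) ∧ (∀ z ∉ D, 7 * ε ≤ dist z a → L z < 0) ∧
      ∀ z ∉ D, dist z a ≤ 7 * ε → ∃ (e : ℂ) (s : ℝ), ‖e‖ = 1 ∧ 1 / (8 * ε) ≤ s ∧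
        HasDerivAt (fun t : ℝ => L (z + t • e)) s 0 := by
  obtain ⟨b, hbU, hba⟩ := exists_far_point_in_component hD hc ha hε hnot
  have haU : a ∈ connectedComponentIn (D ∩ ball a ε) a :=
    mem_connectedComponentIn ⟨ha, mem_ball_self hε⟩
  have hUsub := connectedComponentIn_subset (D ∩ ball a ε) a
  obtain ⟨K, q, hK, hKU, hq, hqlim⟩ := exists_sqrt_branch
    (hD.inter isOpen_ball).connectedComponentIn isPreconnected_connectedComponentIn haU hbU
  have hba' : dist b a < ε := (hUsub hbU).2
  have hKD : ∀ z ∉ D, z ∉ K := fun z hz h => hz (hUsub (hKU h)).1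
  have hKb : ∀ z, ε ≤ dist z a → z ∉ K := fun z hz h => absurd (hUsub (hKU h)).2 (not_lt.2 hz)
  set c : ℂ := (a + b) / 2 with hcdef
  set S : ℂ → ℂ := fun z => (z - a) * q z with hSdef
  set F : ℂ → ℂ := fun z => z - c + S z with hFdef
  have hSan : ∀ z ∉ K, AnalyticAt ℂ S z := fun z hz => by
    have : AnalyticAt ℂ (fun z : ℂ => z - a) z := by fun_prop
    exact this.mul (hq z hz).1
  have hS2 : ∀ z ∉ K, S z ^ 2 = (z - a) * (z - b) := fun z hz => by
    rw [← (hq z hz).2]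
    simp only [hSdef]
    ring
  have hFan : ∀ z ∉ K, AnalyticAt ℂ F z := fun z hz => by
    have : AnalyticAt ℂ (fun z : ℂ => z - c) z := by fun_prop
    exact this.add (hSan z hz)
  have hFF : ∀ z ∉ K, F z * (z - c - S z) = ((a - b) / 2) ^ 2 := fun z hz => by
    have := hS2 z hz
    simp only [hFdef, hcdef]
    linear_combination -this
  have hnab : ‖(a - b) / 2‖ = dist b a / 2 := by
    rw [norm_div, ← dist_eq_norm, dist_comm]
    simp
  have hF0 : ∀ z ∉ K, F z ≠ 0 := fun z hz h => by
    have h1 := hFF z hz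
    rw [h, zero_mul] at h1
    have h2 : ‖((a - b) / 2) ^ 2‖ = 0 := by rw [← h1, norm_zero]
    rw [norm_pow, hnab] at h2
    have : dist b a / 2 = 0 := by simpa using h2
    linarith
  have hSn : ∀ z ∉ K, ‖S z‖ ^ 2 = dist z a * dist z b := fun z hz => by
    rw [← norm_pow, hS2 z hz, norm_mul, dist_eq_norm, dist_eq_norm]
  have hzb : ∀ z, dist z b ≤ dist z a + ε := fun z => by
    have := dist_triangle z a b
    rw [dist_comm a b] at this
    linarith
  have hac : dist a c = dist b a / 2 := by
    rw [dist_eq_norm, ← hnab, hcdef]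
    congr 1
    ring
  have hzc : ∀ z, ‖z - c‖ ≤ dist z a + ε / 2 := fun z => by
    have := dist_triangle z a c
    rw [← dist_eq_norm]
    linarith
  have hzc' : ∀ z, dist z a - ε / 2 ≤ ‖z - c‖ := fun z => by
    have := dist_triangle z c a
    rw [dist_comm c a] at this
    rw [← dist_eq_norm]
    linarith
  have hS7 : ∀ z ∉ K, dist z a ≤ 7 * ε → ‖S z‖ ≤ 15 / 2 * ε := fun z hz hd => by
    have h1 := hSn z hz
    have h2 := hzb z
    have h3 := dist_nonneg (x := z) (y := a)
    have h4 : dist z a * dist z b ≤ 7 * ε * (8 * ε) :=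
      mul_le_mul hd (by linarith) dist_nonneg (by positivity)
    refine abs_le_of_sq_le_sq' ?_ (by positivity) |>.2
    nlinarith
  have hFfar : ∀ z, 7 * ε ≤ dist z a → 6 * ε < ‖F z‖ := by
    intro z hd
    have hzc6 : 13 / 2 * ε ≤ ‖z - c‖ := by linarith [hzc' z]
    have hzc0 : z - c ≠ 0 := norm_pos_iff.1 (by linarith)
    set ζ : ℝ → ℂ := fun t => z + t • (z - c) with hζ
    have hζc : ∀ t, ζ t - c = ((1 + t : ℝ) : ℂ) * (z - c) := fun t => by
      simp only [hζ, Complex.real_smul]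
      push_cast
      ring
    have hζn : ∀ t, 0 ≤ t → ‖z - c‖ ≤ ‖ζ t - c‖ := fun t ht => by
      rw [hζc, norm_mul, Complex.norm_real, Real.norm_of_nonneg (by linarith)]
      nlinarith [norm_nonneg (z - c)]
    have hζK : ∀ t, 0 ≤ t → ζ t ∉ K := fun t ht => hKb _ (by
      linarith [hζn t ht, hzc (ζ t)])
    have hζ0 : ∀ t, 0 ≤ t → ζ t - c ≠ 0 := fun t ht => norm_pos_iff.1 (by linarith [hζn t ht])
    set T : ℝ → ℂ := fun t => S (ζ t) / (ζ t - c) with hT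
    have hζcont : Continuous ζ := by fun_prop
    have hTcont : ContinuousOn T (Ici 0) := by
      intro t ht
      have h1 : ContinuousAt (fun t => S (ζ t)) t :=
        ContinuousAt.comp (hSan _ (hζK t ht)).continuousAt hζcont.continuousAt
      have h2 : ContinuousAt (fun t => ζ t - c) t := by fun_prop
      exact (h1.div h2 (hζ0 t ht)).continuousWithinAt
    have hTre : ∀ t, 0 ≤ t → (T t).re ≠ 0 := by
      intro t ht hre
      have h1 : T t ^ 2 = 1 - ((a - b) / 2 / (ζ t - c)) ^ 2 := by
        have h2 := hS2 _ (hζK t ht)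
        have h3 := hζ0 t ht
        simp only [hT]
        rw [div_pow, div_pow, h2, eq_sub_iff_add_eq, ← add_div, div_eq_one_iff_eq (pow_ne_zero 2 h3),
          hcdef]
        ring
      have h4 : ‖(a - b) / 2 / (ζ t - c)‖ < 1 := by
        rw [norm_div, hnab, div_lt_one (norm_pos_iff.2 (hζ0 t ht))]
        linarith [hζn t ht]
      have h5 : (T t ^ 2).re ≤ 0 := by
        rw [sq, Complex.mul_re, hre]
        nlinarith [sq_nonneg (T t).im]
      have h6 : (((a - b) / 2 / (ζ t - c)) ^ 2).re < 1 := by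
        refine (Complex.re_le_norm _).trans_lt ?_
        rw [norm_pow]
        exact pow_lt_one₀ (norm_nonneg _) h4 two_ne_zero
      rw [h1, Complex.sub_re, Complex.one_re] at h5
      linarith
    have hζinf : Tendsto ζ atTop (cocompact ℂ) := by
      rw [← Metric.cobounded_eq_cocompact, ← tendsto_norm_atTop_iff_cobounded]
      have h1 : Tendsto (fun t : ℝ => t * ‖z - c‖ - ‖z‖) atTop atTop :=
        tendsto_atTop_add_const_right _ _ (tendsto_id.atTop_mul_const (norm_pos_iff.2 hzc0))
      refine tendsto_atTop_mono' _ ?_ h1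
      filter_upwards [eventually_ge_atTop 0] with t ht
      have h2 : ‖t • (z - c)‖ = t * ‖z - c‖ := by rw [norm_smul, Real.norm_of_nonneg ht]
      have h3 := norm_sub_norm_le (t • (z - c)) (-z)
      rw [norm_neg, sub_neg_eq_add, add_comm (t • (z - c)) z, h2] at h3
      exact h3
    have hTlim : Tendsto T atTop (𝓝 1) := by
      have h1 : Tendsto (fun t => (ζ t - c)⁻¹) atTop (𝓝 0) := by
        rw [← Metric.cobounded_eq_cocompact] at hζinf
        exact (tendsto_inv₀_cobounded (α := ℂ)).comp ((tendsto_sub_const_cobounded c).comp hζinf)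
      have h2 : Tendsto (fun t => (1 + (c - a) * (ζ t - c)⁻¹) * q (ζ t)) atTop (𝓝 1) := by
        simpa using ((h1.const_mul (c - a)).const_add 1).mul (hqlim.comp hζinf)
      refine h2.congr' ?_
      filter_upwards [eventually_ge_atTop 0] with t ht
      have h3 := hζ0 t ht
      simp only [hT, hSdef]
      field_simp
      ring
    have hT0 : 0 < (T 0).re := by
      by_contra! hneg
      have h1 : ∀ᶠ t in atTop, 0 < (T t).re :=
        ((Complex.continuous_re.tendsto _).comp hTlim).eventually (lt_mem_nhds (by simp))
      obtain ⟨t, ht1, ht2⟩ := (h1.and (eventually_ge_atTop 0)).exists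
      have h2 : ContinuousOn (fun t => (T t).re) (Icc 0 t) :=
        Complex.continuous_re.comp_continuousOn (hTcont.mono Icc_subset_Ici_self)
      obtain ⟨s, hs, hs0⟩ := intermediate_value_Icc ht2 h2 ⟨hneg, ht1.le⟩
      exact hTre s hs.1 hs0
    have hFT : F z = (z - c) * (1 + T 0) := by
      simp only [hT, hζ, zero_smul, add_zero, hFdef]
      field_simp
    have h1 : 1 ≤ ‖1 + T 0‖ := by
      refine le_trans ?_ (Complex.re_le_norm _)
      rw [Complex.add_re, Complex.one_re]
      linarith
    rw [hFT, norm_mul]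
    nlinarith [norm_nonneg (z - c)]
  refine ⟨fun z => Real.log (6 * ε) - Real.log ‖F z‖, ?_, ?_, ?_, ?_, ?_⟩
  · intro z hz
    exact (harmonicAt_const _).sub ((hFan z (hKD z hz)).harmonicAt_log_norm (hF0 z (hKD z hz)))
  · intro z hz
    have hzK := hKD z hz
    have hFp : 0 < ‖F z‖ := norm_pos_iff.2 (hF0 z hzK)
    rcases le_total (7 * ε) (dist z a) with hd | hd
    · have := Real.log_le_log (by positivity) (hFfar z hd).le
      linarith
    · have h1 : ‖z - c - S z‖ ≤ 15 * ε := by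
        have := norm_sub_le (z - c) (S z)
        linarith [hzc z, hS7 z hzK hd]
      have h2 : ‖F z‖ * ‖z - c - S z‖ = (dist b a / 2) ^ 2 := by
        rw [← norm_mul, hFF z hzK, norm_pow, hnab]
      have h3 : ε ^ 2 / 16 ≤ ‖F z‖ * (15 * ε) := by
        have := mul_le_mul_of_nonneg_left h1 hFp.le
        nlinarith
      have h4 : 6 * ε ≤ 1440 * ‖F z‖ := by nlinarith
      have h5 : Real.log (6 * ε) ≤ Real.log 1440 + Real.log ‖F z‖ := by
        rw [← Real.log_mul (by norm_num) hFp.ne']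
        exact Real.log_le_log (by positivity) h4
      have h6 : Real.log 1440 ≤ 8 := by
        rw [Real.log_le_iff_le_exp (by norm_num)]
        have h7 := Real.exp_one_gt_d9
        have h8 : Real.exp 8 = Real.exp 1 ^ 8 := by rw [← Real.exp_nat_mul]; norm_num
        rw [h8]
        calc (1440 : ℝ) ≤ 2.7 ^ 8 := by norm_num
          _ ≤ Real.exp 1 ^ 8 := by gcongr; linarith
      linarith
  · intro z hz hd
    have hzK := hKD z hz
    have hFp : 0 < ‖F z‖ := norm_pos_iff.2 (hF0 z hzK)
    have h1 : ‖S z‖ ≤ 5 / 2 * ε := by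
      have h1 := hSn z hzK
      have h2 := hzb z
      have h4 : dist z a * dist z b ≤ 2 * ε * (3 * ε) :=
        mul_le_mul hd.le (by linarith) dist_nonneg (by positivity)
      refine abs_le_of_sq_le_sq' ?_ (by positivity) |>.2
      nlinarith
    have h2 : ‖F z‖ < 6 * ε := by
      have := norm_add_le (z - c) (S z)
      simp only [hFdef]
      linarith [hzc z]
    have := Real.log_lt_log hFp h2
    linarith
  · intro z hz hd
    have := Real.log_lt_log (by positivity) (hFfar z hd)
    linarith
  · intro z hz hd
    have hzK := hKD z hz
    have hza : z ≠ a := fun h => hz (h ▸ ha)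
    have hzb : z ≠ b := fun h => hz (h ▸ (hUsub hbU).1)
    have hS0 : S z ≠ 0 := fun h => by
      have h1 := hS2 z hzK
      rw [h] at h1
      have : (z - a) * (z - b) ≠ 0 := mul_ne_zero (sub_ne_zero.2 hza) (sub_ne_zero.2 hzb)
      exact this (by rw [← h1]; ring)
    have hSp : 0 < ‖S z‖ := norm_pos_iff.2 hS0
    have hSd : HasDerivAt S ((z - c) / S z) z := by
      have h1 := (hSan z hzK).differentiableAt.hasDerivAt
      have h2 : HasDerivAt (fun w => S w ^ 2) (2 * S z * deriv S z) z := by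
        have := h1.pow 2
        simp only [Nat.cast_ofNat, Nat.add_one_sub_one, pow_one] at this
        exact this
      have h3 : HasDerivAt (fun w : ℂ => (w - a) * (w - b)) (1 * (z - b) + (z - a) * 1) z :=
        ((hasDerivAt_id z).sub_const a).mul ((hasDerivAt_id z).sub_const b)
      have h4 : (fun w => S w ^ 2) =ᶠ[𝓝 z] fun w => (w - a) * (w - b) := by
        filter_upwards [hK.isClosed.isOpen_compl.mem_nhds hzK] with w hw using hS2 w hw
      have h5 := h2.unique (h3.congr_of_eventuallyEq h4)
      have h6 : deriv S z = (z - c) / S z := by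
        rw [eq_div_iff hS0, hcdef]
        linear_combination h5 / 2
      rwa [h6] at h1
    have hFd : HasDerivAt F (F z / S z) z := by
      have h1 := ((hasDerivAt_id z).sub_const c).add hSd
      have h2 : 1 + (z - c) / S z = F z / S z := by
        simp only [hFdef]
        field_simp
        ring
      rwa [h2] at h1
    set e : ℂ := -(S z / ‖S z‖) with he
    refine ⟨e, ‖S z‖⁻¹, ?_, ?_, ?_⟩
    · rw [he, norm_neg, norm_div, Complex.norm_real, norm_norm, div_self hSp.ne']
    · rw [← one_div]
      exact one_div_le_one_div_of_le hSp (by linarith [hS7 z hzK hd])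
    · have hline : HasDerivAt (fun t : ℝ => z + t • e) e 0 := by
        simpa using ((hasDerivAt_id (0 : ℝ)).smul_const e).const_add z
      have hFd' : HasDerivAt F (F z / S z) (z + (0 : ℝ) • e) := by simpa using hFd
      have hγ : HasDerivAt (fun t : ℝ => F (z + t • e)) (e • (F z / S z)) 0 :=
        hFd'.scomp 0 hline
      have h7 : e • (F z / S z) = (-‖S z‖⁻¹) • F (z + (0 : ℝ) • e) := by
        simp only [zero_smul, add_zero, smul_eq_mul, Complex.real_smul, he]
        have : (‖S z‖ : ℂ) ≠ 0 := by exact_mod_cast hSp.ne'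
        push_cast
        field_simp
      rw [h7] at hγ
      have h8 := (hasDerivAt_log_norm hγ (by simpa using hF0 z hzK)).const_sub (Real.log (6 * ε))
      simpa using h8

end SqrtBarrier

theorem exists_log_barrier {D : Set Plane} (hD : IsOpen D) (hc : IsPreconnected D) {a : Plane}
    (ha : a ∈ D) {ε : ℝ} (hε : 0 < ε) (hnot : ¬ D ⊆ ball a (ε / 2)) :
    ∃ L : Plane → ℝ, (∀ x ∉ D, HarmonicAt L x) ∧ (∀ x ∉ D, L x ≤ 8) ∧
      (∀ x ∉ D, dist x a < 2 * ε → 0 < L x) ∧ (∀ x ∉ D, 7 * ε ≤ dist x a → L x < 0) ∧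
      ∀ x ∉ D, dist x a ≤ 7 * ε → ∃ (e : Plane) (s : ℝ), ‖e‖ = 1 ∧ 1 / (8 * ε) ≤ s ∧
        HasDerivAt (fun t : ℝ => L (x + t • e)) s 0 := by
  have hmem : ∀ x, x ∉ D → toC x ∉ toC '' D := fun x hx h => hx (by simpa using h)
  have hopen : IsOpen (toC '' D) := toC.toHomeomorph.isOpenMap D hD
  have hnot' : ¬ toC '' D ⊆ ball (toC a) (ε / 2) := fun h => hnot fun x hx => by
    have := h (mem_image_of_mem toC hx)
    rwa [mem_ball, toC.dist_map] at this
  obtain ⟨L, h1, h2, h3, h4, h5⟩ := exists_log_barrier_complex hopen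
    (hc.image _ toC.continuous.continuousOn) (mem_image_of_mem toC ha) hε hnot'
  refine ⟨L ∘ toC, fun x hx => harmonicAt_comp_toC (h1 _ (hmem x hx)), fun x hx => h2 _ (hmem x hx),
    fun x hx hd => h3 _ (hmem x hx) (by rwa [toC.dist_map]),
    fun x hx hd => h4 _ (hmem x hx) (by rwa [toC.dist_map]), fun x hx hd => ?_⟩
  obtain ⟨e, s, he, hs, hder⟩ := h5 _ (hmem x hx) (by rwa [toC.dist_map])
  refine ⟨toC.symm e, s, by simpa using he, hs, ?_⟩
  simpa using hder

/-- A lower barrier: away from `D` it is subharmonic where positive, and it leaves zero with slope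
at least `σ`. It is bounded by `m` and vanishes at distance at least `δ` from `D`. -/
structure IsLowerBarrier (D : Set Plane) (m σ δ : ℝ) (W : Plane → ℝ) : Prop where
  continuousOn : ContinuousOn W Dᶜ
  nonneg : ∀ x, 0 ≤ W x
  le : ∀ x ∉ D, W x ≤ m
  eq_zero : ∀ x ∉ D, δ ≤ infDist x D → W x = 0
  visc : ∀ x ∉ closure D, 0 < W x → ViscSubAt W x
  slope : ∀ x ∉ closure D, W x = 0 → x ∈ closure (posSet D W) → ∀ f : Plane → ℝ, √(f x) ≤ σ →
    SubFBAt D f W x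

theorem isLowerBarrier_zero {D : Set Plane} {m σ δ : ℝ} (hm : 0 ≤ m) :
    IsLowerBarrier D m σ δ fun _ => 0 where
  continuousOn := continuousOn_const
  nonneg _ := le_rfl
  le _ _ := hm
  eq_zero _ _ _ := rfl
  visc _ _ h := absurd h (lt_irrefl _)
  slope x _ _ hcl := by
    have : posSet D (fun _ => (0 : ℝ)) = ∅ := by ext; simp [posSet]
    simp [this] at hcl

theorem IsLowerBarrier.sup {D : Set Plane} {m σ δ : ℝ} {v w : Plane → ℝ}
    (hv : IsLowerBarrier D m σ δ v) (hw : IsLowerBarrier D m σ δ w) :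
    IsLowerBarrier D m σ δ fun x => max (v x) (w x) where
  continuousOn := ContinuousOn.sup hv.continuousOn hw.continuousOn
  nonneg x := le_max_of_le_left (hv.nonneg x)
  le x hx := max_le (hv.le x hx) (hw.le x hx)
  eq_zero x hx hd := by rw [hv.eq_zero x hx hd, hw.eq_zero x hx hd, max_self]
  visc x hx hpos := by
    rcases le_total (w x) (v x) with hle | hle
    · refine ViscSubAt.of_le (w := v) (hv.visc x hx ?_)
        (Eventually.of_forall fun y => le_max_left _ _) (max_eq_left hle).symm
      rwa [max_eq_left hle] at hpos
    · refine ViscSubAt.of_le (w := w) (hw.visc x hx ?_)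
        (Eventually.of_forall fun y => le_max_right _ _) (max_eq_right hle).symm
      rwa [max_eq_right hle] at hpos
  slope x hx h0 hcl f hf := by
    have hsub : posSet D (fun x => max (v x) (w x)) ⊆ posSet D v ∪ posSet D w := by
      rintro y ⟨hyD, hy⟩
      rcases lt_max_iff.1 hy with hy | hy
      · exact Or.inl ⟨hyD, hy⟩
      · exact Or.inr ⟨hyD, hy⟩
    have hcl := closure_mono hsub hcl
    rw [closure_union] at hcl
    have hv0 : v x = 0 := le_antisymm ((le_max_left _ _).trans h0.le) (hv.nonneg x)
    have hw0 : w x = 0 := le_antisymm ((le_max_right _ _).trans h0.le) (hw.nonneg x)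
    rcases hcl with hcl | hcl
    · exact (hv.slope x hx hv0 hcl f hf).of_le fun _ _ => le_max_left _ _
    · exact (hw.slope x hx hw0 hcl f hf).of_le fun _ _ => le_max_right _ _

theorem exists_isLowerBarrier_ball {D : Set Plane} (hD : IsOpen D) (hc : IsPreconnected D)
    {a : Plane} (ha : a ∈ D) {ε m σ : ℝ} (hε : 0 < ε) (hnot : ¬ D ⊆ ball a (ε / 2)) (hm : 0 < m)
    (hσ : σ ≤ m / 8 * (1 / (8 * ε))) :
    ∃ W, IsLowerBarrier D m σ (7 * ε) W ∧ ∀ x ∉ D, dist x a < 2 * ε → 0 < W x := by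
  obtain ⟨L, hharm, hle, hpos, hneg, hsl⟩ := exists_log_barrier hD hc ha hε hnot
  have hcL : ∀ x ∉ D, ContinuousAt L x := fun x hx => (hharm x hx).1.continuousAt
  have hκ : 0 < m / 8 := by positivity
  have hLW : ∀ x, m / 8 * L x ≤ m / 8 * max (L x) 0 := fun x =>
    mul_le_mul_of_nonneg_left (le_max_left _ _) hκ.le
  have hWpos : ∀ x, 0 < m / 8 * max (L x) 0 → 0 < L x := fun x hx => by
    have := (mul_pos_iff_of_pos_left hκ).1 hx
    simpa using this
  refine ⟨fun x => m / 8 * max (L x) 0, ⟨?_, ?_, ?_, ?_, ?_, ?_⟩, ?_⟩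
  · intro x hx
    have : ContinuousAt (fun x => m / 8 * max (L x) 0) x :=
      continuousAt_const.mul ((hcL x hx).max continuousAt_const)
    exact this.continuousWithinAt
  · intro x
    positivity
  · intro x hx
    have : max (L x) 0 ≤ 8 := max_le (hle x hx) (by norm_num)
    nlinarith
  · intro x hx hd
    have := hneg x hx (hd.trans (infDist_le_dist_of_mem ha))
    rw [max_eq_right this.le, mul_zero]
  · intro x hx hp
    have hxD : x ∉ D := fun h => hx (subset_closure h)
    have h1 : HarmonicAt ((m / 8) • L) x := (hharm x hxD).const_smul
    refine (viscSubAt_of_harmonicAt h1).of_le (Eventually.of_forall hLW) ?_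
    simp [max_eq_left (hWpos x hp).le]
  · intro x hx h0 hcl f hf
    have hxD : x ∉ D := fun h => hx (subset_closure h)
    have hL0 : L x = 0 := by
      refine le_antisymm ?_ ?_
      · by_contra! hlt
        have : 0 < m / 8 * max (L x) 0 := mul_pos hκ (lt_max_of_lt_left hlt)
        linarith
      · by_contra! hlt
        have h1 := (hcL x hxD).eventually (gt_mem_nhds hlt)
        obtain ⟨y, hy1, hy2⟩ := (mem_closure_iff_frequently.1 hcl |>.and_eventually h1).exists
        exact lt_asymm hy2 (hWpos y hy1.2)
    have hd : dist x a ≤ 7 * ε := by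
      by_contra! hlt
      linarith [hneg x hxD hlt.le]
    obtain ⟨e, s, he, hs, hder⟩ := hsl x hxD hd
    have h8 : m / 8 * (1 / (8 * ε)) ≤ m / 8 * s := mul_le_mul_of_nonneg_left hs hκ.le
    have hs0 : 0 < m / 8 * s := lt_of_lt_of_le (by positivity) h8
    refine subFBAt_of_slope (L := fun y => m / 8 * L y) hx (Eventually.of_forall hLW)
      (by simp [hL0]) he hs0 (hf.trans (hσ.trans h8)) (hder.const_mul _)
  · intro x hx hd
    exact mul_pos hκ (lt_max_of_lt_left (hpos x hx hd))

theorem le_of_ball_subset_ball {a b : Plane} {s t : ℝ} (hs : 0 < s) (h : ball a s ⊆ ball b t) :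
    s ≤ t := by
  by_contra! hlt
  set τ := max t 0 with hτ
  have hτs : τ < s := max_lt hlt hs
  obtain ⟨v, hv⟩ : ∃ v : Plane, ‖v‖ = τ := exists_norm_eq Plane (le_max_right _ _)
  have h1 := mem_ball.1 (h (show a + v ∈ ball a s by rwa [mem_ball, dist_self_add_left, hv]))
  have h2 := mem_ball.1 (h (show a - v ∈ ball a s by rwa [mem_ball, dist_self_sub_left, hv]))
  have h3 := dist_triangle_right (a + v) (a - v) b
  have h4 : dist (a + v) (a - v) = 2 * τ := by
    rw [dist_eq_norm]
    have : a + v - (a - v) = (2 : ℝ) • v := by rw [two_smul]; abel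
    rw [this, norm_smul, hv, Real.norm_two]
  have : t ≤ τ := le_max_left _ _
  linarith

/-- A lower barrier which is positive in a neighbourhood of `D`. -/
theorem exists_isLowerBarrier {D : Set Plane} (hD : IsOpen D) (hc : IsConnected D)
    (hb : Bornology.IsBounded D) {m σ δ : ℝ} (hm : 0 < m) (hσ : 0 < σ) (hδ : 0 < δ) :
    ∃ δ₀ > 0, ∃ W, IsLowerBarrier D m σ δ W ∧ ∀ x ∉ D, infDist x D < δ₀ → 0 < W x := by
  obtain ⟨a₀, ha₀⟩ := hc.nonempty
  obtain ⟨η, hη, hηD⟩ := Metric.isOpen_iff.1 hD a₀ ha₀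
  set ε := min (δ / 7) (min (m / 8 / (8 * σ)) η) with hε
  have hε0 : 0 < ε := by positivity
  have hε1 : 7 * ε ≤ δ := by
    have : ε ≤ δ / 7 := min_le_left _ _
    linarith
  have hε2 : σ ≤ m / 8 * (1 / (8 * ε)) := by
    have h1 : ε ≤ m / 8 / (8 * σ) := (min_le_right _ _).trans (min_le_left _ _)
    rw [le_div_iff₀ (by positivity)] at h1
    rw [mul_one_div, le_div_iff₀ (by positivity)]
    linarith
  have hε3 : ε ≤ η := (min_le_right _ _).trans (min_le_right _ _)
  have hnot : ∀ a, ¬ D ⊆ ball a (ε / 2) := by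
    intro a hsub
    have := le_of_ball_subset_ball hη (hηD.trans hsub)
    linarith
  have hmono : ∀ {W}, IsLowerBarrier D m σ (7 * ε) W → IsLowerBarrier D m σ δ W := fun hW =>
    ⟨hW.1, hW.2, hW.3, fun x hx hd => hW.4 x hx (hε1.trans hd), hW.5, hW.6⟩
  obtain ⟨W, hW, hWpos⟩ : ∃ W, IsLowerBarrier D m σ δ W ∧
      ∀ x ∉ D, (∃ y ∈ closure D, dist x y < ε) → 0 < W x := by
    refine hb.isCompact_closure.induction_on (p := fun s => ∃ W, IsLowerBarrier D m σ δ W ∧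
      ∀ x ∉ D, (∃ y ∈ s, dist x y < ε) → 0 < W x) ?_ ?_ ?_ ?_
    · exact ⟨_, isLowerBarrier_zero hm.le, by simp⟩
    · rintro s t hst ⟨W, hW, h1⟩
      exact ⟨W, hW, fun x hx ⟨y, hy, hd⟩ => h1 x hx ⟨y, hst hy, hd⟩⟩
    · rintro s t ⟨v, hv, h1⟩ ⟨w, hw, h2⟩
      refine ⟨_, hv.sup hw, ?_⟩
      rintro x hx ⟨y, hy | hy, hd⟩
      · exact lt_max_of_lt_left (h1 x hx ⟨y, hy, hd⟩)
      · exact lt_max_of_lt_right (h2 x hx ⟨y, hy, hd⟩)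
    · intro x hx
      obtain ⟨a, ha, hxa⟩ := Metric.mem_closure_iff.1 hx ε hε0
      obtain ⟨W, hW, hWpos⟩ := exists_isLowerBarrier_ball hD hc.isPreconnected ha hε0 (hnot a) hm hε2
      refine ⟨ball a ε, nhdsWithin_le_nhds (isOpen_ball.mem_nhds hxa), W, hmono hW, ?_⟩
      rintro z hz ⟨y, hy, hd⟩
      have hy' : dist y a < ε := hy
      exact hWpos z hz (by linarith [dist_triangle z y a])
  refine ⟨ε, hε0, W, hW, fun x hx hd => ?_⟩
  obtain ⟨y, hy, hxy⟩ := (infDist_lt_iff hc.nonempty).1 hd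
  exact hWpos x hx ⟨y, subset_closure hy, hxy⟩

theorem infDist_eq_zero_of_mem_closure' {D : Set Plane} {x : Plane} (hx : x ∈ closure D) :
    infDist x D = 0 :=
  (mem_closure_iff_infDist_zero (closure_nonempty_iff.1 ⟨x, hx⟩)).1 hx

theorem IsLowerBarrier.admissible {D : Set Plane} {m σ δ δ₀ : ℝ} {f g h W : Plane → ℝ}
    (hW : IsLowerBarrier D m σ δ W) (hδ₀ : 0 < δ₀)
    (hpos : ∀ x ∉ D, infDist x D < δ₀ → 0 < W x) (hg : ∀ x ∈ frontier D, m ≤ g x)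
    (hf : ∀ x, √(f x) ≤ σ) (hD : IsOpen D)
    (hh0 : ∀ x, 0 ≤ h x) (hh : ∀ x ∉ D, infDist x D < δ → m ≤ h x) : Admissible D f g h W := by
  refine ⟨⟨hW.continuousOn, fun x _ => hW.nonneg x, fun x hx hxD => hW.visc x hxD hx.2, ?_, ?_⟩, ?_⟩
  · intro x hx
    exact (hW.le x (fun h => hx.2 (by rwa [hD.interior_eq]))).trans (hg x hx)
  · intro x hx
    have h0 : W x = 0 :=
      le_antisymm (nonpos_of_mem_freeBoundary (eventually_pos_of_pos hW.continuousOn hx.1.1) hx)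
        (hW.nonneg x)
    refine hW.slope x (fun hcl => ?_) h0 hx.1.2 f (hf x)
    have := hpos x hx.1.1 (by rwa [infDist_eq_zero_of_mem_closure' hcl])
    linarith
  · intro y hy
    rcases lt_or_ge (infDist y D) δ with hlt | hge
    · exact (hW.le y hy).trans (hh y hy hlt)
    · rw [hW.eq_zero y hy hge]
      exact hh0 y

section LogSupersolution

variable {lam r G : ℝ}

theorem outerRadius_spec (hlam : 0 < lam) (hr : 0 < r) (hG : 0 < G) :
    r < outerRadius lam r G ∧
      G = √lam * outerRadius lam r G * Real.log (outerRadius lam r G / r) := by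
  have hsl : 0 < √lam := Real.sqrt_pos.2 hlam
  have hmono : ∀ s t, r ≤ s → s < t → s * Real.log (s / r) < t * Real.log (t / r) := by
    intro s t hs hst
    have hs0 : 0 < s := hr.trans_le hs
    have h1 : 0 ≤ Real.log (s / r) := Real.log_nonneg (by rwa [le_div_iff₀ hr, one_mul])
    have h2 : Real.log (s / r) < Real.log (t / r) :=
      Real.log_lt_log (by positivity) (div_lt_div_of_pos_right hst hr)
    nlinarith
  obtain ⟨R, hR, hReq⟩ : ∃ R, r < R ∧ R * Real.log (R / r) = G / √lam := by
    have hcont : ContinuousOn (fun s => s * Real.log (s / r))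
        (Icc r (r * Real.exp 1 + G / √lam)) := by
      intro s hs
      have hs0 : s ≠ 0 := (hr.trans_le hs.1).ne'
      have : ContinuousAt (fun s => s * Real.log (s / r)) s :=
        continuousAt_id.mul ((continuousAt_id.div_const r).log (by positivity))
      exact this.continuousWithinAt
    have hexp : 1 ≤ Real.exp 1 := Real.one_le_exp (by norm_num)
    have hpos : 0 < G / √lam := by positivity
    have hle : r ≤ r * Real.exp 1 + G / √lam := by nlinarith
    have hend : G / √lam ≤ (r * Real.exp 1 + G / √lam) *
        Real.log ((r * Real.exp 1 + G / √lam) / r) := by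
      have h1 : 1 ≤ Real.log ((r * Real.exp 1 + G / √lam) / r) := by
        rw [Real.le_log_iff_exp_le (by positivity), le_div_iff₀ hr]
        linarith
      nlinarith [mul_pos hr (Real.exp_pos 1)]
    obtain ⟨R, hR, hReq⟩ := intermediate_value_Icc hle hcont
      (show G / √lam ∈ Icc _ _ from ⟨by simp [div_self hr.ne', hpos.le], hend⟩)
    refine ⟨R, lt_of_le_of_ne hR.1 ?_, hReq⟩
    rintro rfl
    simp only [div_self hr.ne', Real.log_one, mul_zero] at hReq
    linarith
  have hset : {R : ℝ | r < R ∧ G ^ 2 / (R ^ 2 * Real.log (r / R) ^ 2) < lam} = Ioi R := by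
    ext s
    simp only [mem_ofPred_eq, mem_Ioi]
    have key : ∀ s, r < s → (G ^ 2 / (s ^ 2 * Real.log (r / s) ^ 2) < lam ↔
        G / √lam < s * Real.log (s / r)) := by
      intro s hs
      have hs0 : 0 < s := hr.trans hs
      have hl : 0 < Real.log (s / r) := Real.log_pos (by rwa [lt_div_iff₀ hr, one_mul])
      have h1 : Real.log (r / s) = -Real.log (s / r) := by rw [← Real.log_inv, inv_div]
      rw [h1, neg_sq, ← mul_pow, ← div_pow, div_lt_iff₀ hsl, ← Real.lt_sqrt (by positivity),
        div_lt_iff₀ (by positivity), mul_comm (√lam)]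
    constructor
    · rintro ⟨h1, h2⟩
      rw [key s h1, ← hReq] at h2
      by_contra! hle
      rcases hle.lt_or_eq with hlt | heq
      · linarith [hmono s R h1.le hlt]
      · rw [heq] at h2
        exact lt_irrefl _ h2
    · intro h1
      refine ⟨hR.trans h1, ?_⟩
      rw [key s (hR.trans h1), ← hReq]
      exact hmono R s hR.le h1
  have hout : outerRadius lam r G = R := by
    rw [outerRadius, hset, csInf_Ioi]
  rw [hout]
  refine ⟨hR, ?_⟩
  rw [mul_assoc, hReq, mul_div_cancel₀ _ hsl.ne']

theorem logSupersolution_eq (hlam : 0 < lam) (hr : 0 < r) (hG : 0 < G) (p x : Plane) :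
    logSupersolution lam p r G x =
      max (√lam * outerRadius lam r G * Real.log (outerRadius lam r G / dist x p)) 0 := by
  obtain ⟨h1, h2⟩ := outerRadius_spec hlam hr hG
  set R := outerRadius lam r G with hR
  have hl : 0 < Real.log (R / r) := Real.log_pos (by rwa [lt_div_iff₀ hr, one_mul])
  have h3 : Real.log (r / R) = -Real.log (R / r) := by rw [← Real.log_inv, inv_div]
  have h4 : Real.log (dist x p / R) = -Real.log (R / dist x p) := by rw [← Real.log_inv, inv_div]
  rw [logSupersolution, ← hR, h3, h4, neg_div_neg_eq]
  congr 1
  nth_rewrite 1 [h2]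
  field_simp

theorem logSupersolution_nonneg (p x : Plane) : 0 ≤ logSupersolution lam p r G x :=
  le_max_right _ _

theorem logSupersolution_eq_zero (hlam : 0 < lam) (hr : 0 < r) (hG : 0 < G) {p x : Plane}
    (hx : outerRadius lam r G ≤ dist x p) : logSupersolution lam p r G x = 0 := by
  rw [logSupersolution_eq hlam hr hG]
  have hR := hr.trans (outerRadius_spec hlam hr hG).1
  refine max_eq_right (mul_nonpos_of_nonneg_of_nonpos (by positivity) ?_)
  refine Real.log_nonpos (by positivity) ?_
  rwa [div_le_one (hR.trans_le hx)]

theorem harmonicAt_logSupersolution (hlam : 0 < lam) (hr : 0 < r) (hG : 0 < G) {p x : Plane}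
    (hx : x ≠ p) (hlt : dist x p < outerRadius lam r G) :
    HarmonicAt (logSupersolution lam p r G) x := by
  have hR := hr.trans (outerRadius_spec hlam hr hG).1
  set R := outerRadius lam r G with hRdef
  have hsl : 0 < √lam := Real.sqrt_pos.2 hlam
  have h1 : HarmonicAt ((fun _ => √lam * R * Real.log R) -
      (√lam * R) • fun y => Real.log (dist y p)) x :=
    (harmonicAt_const _).sub (harmonicAt_log_dist hx).const_smul
  refine (harmonicAt_congr_nhds ?_).2 h1
  have hc : Continuous fun y : Plane => dist y p := by fun_prop
  filter_upwards [hc.continuousAt.eventually (gt_mem_nhds hlt),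
    hc.continuousAt.eventually (lt_mem_nhds (dist_pos.2 hx))] with y hy1 hy2
  rw [logSupersolution_eq hlam hr hG, ← hRdef, max_eq_left, Real.log_div hR.ne' hy2.ne']
  · simp only [Pi.sub_apply, Pi.smul_apply, smul_eq_mul]
    ring
  · have := Real.log_nonneg ((one_le_div hy2).2 hy1.le)
    positivity

theorem dist_lt_outerRadius_of_pos (hlam : 0 < lam) (hr : 0 < r) (hG : 0 < G) {p x : Plane}
    (hx : 0 < logSupersolution lam p r G x) : dist x p < outerRadius lam r G := by
  by_contra! hle
  rw [logSupersolution_eq_zero hlam hr hG hle] at hx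
  exact lt_irrefl _ hx

theorem isUpperBarrier_logSupersolution {D : Set Plane} (hlam : 0 < lam) (hr : 0 < r) (hG : 0 < G)
    {p : Plane} (hp : p ∈ D) : IsUpperBarrier D (logSupersolution lam p r G) where
  nonneg := logSupersolution_nonneg p
  harmonic _ hx hpos := harmonicAt_logSupersolution hlam hr hG (fun h => hx (h ▸ hp))
    (dist_lt_outerRadius_of_pos hlam hr hG hpos)
  support := ⟨p, outerRadius lam r G, fun _ hx => logSupersolution_eq_zero hlam hr hG hx⟩

theorem logSupersolution_le_of_near (hlam : 0 < lam) (hr : 0 < r) (hG : 0 < G) {p x : Plane} {d : ℝ}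
    (hd : 0 < d) (hdp : d ≤ dist x p) (hR : outerRadius lam r G ≤ dist x p + d) :
    logSupersolution lam p r G x ≤ 2 * √lam * d := by
  have hR0 := hr.trans (outerRadius_spec hlam hr hG).1
  rw [logSupersolution_eq hlam hr hG]
  set R := outerRadius lam r G
  have hρ : 0 < dist x p := hd.trans_le hdp
  refine max_le ?_ (by positivity)
  have h1 : Real.log (R / dist x p) ≤ d / dist x p := by
    refine (Real.log_le_sub_one_of_pos (by positivity)).trans ?_
    rw [sub_le_iff_le_add, div_add_one hρ.ne']
    gcongr
    linarith
  calc √lam * R * Real.log (R / dist x p) ≤ √lam * R * (d / dist x p) := by gcongr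
    _ ≤ √lam * (2 * dist x p) * (d / dist x p) := by
        gcongr
        linarith
    _ = 2 * √lam * d := by field_simp

theorem le_logSupersolution_of_near (hlam : 0 < lam) (hr : 0 < r) (hG : 0 < G) {p x : Plane}
    {t m : ℝ} (hmG : 2 * m ≤ G) (ht : 0 < t) (htr : t ≤ r / 4)
    (htm : t * (2 * √lam) ≤ m) (hxp : x ≠ p) (hx : dist x p ≤ r + t) :
    m ≤ logSupersolution lam p r G x := by
  obtain ⟨hR1, hR2⟩ := outerRadius_spec hlam hr hG
  rw [logSupersolution_eq hlam hr hG]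
  refine le_max_of_le_left ?_
  set R := outerRadius lam r G
  have hR0 : 0 < R := hr.trans hR1
  have hsl : 0 < √lam := Real.sqrt_pos.2 hlam
  have hρ : 0 < dist x p := dist_pos.2 hxp
  have hlr : 0 < Real.log (R / r) := Real.log_pos (by rwa [lt_div_iff₀ hr, one_mul])
  have h1 : Real.log (R / r) - t / r ≤ Real.log (R / dist x p) := by
    have h2 : Real.log (R / (r + t)) ≤ Real.log (R / dist x p) :=
      Real.log_le_log (by positivity) (by gcongr)
    have h3 : Real.log (R / (r + t)) = Real.log (R / r) - Real.log ((r + t) / r) := by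
      rw [← Real.log_div (by positivity) (by positivity)]
      congr 1
      field_simp
    have h4 : Real.log ((r + t) / r) ≤ t / r := by
      refine (Real.log_le_sub_one_of_pos (by positivity)).trans ?_
      rw [add_div, div_self hr.ne']
      linarith
    linarith
  have h5 : G - √lam * R * (t / r) ≤ √lam * R * Real.log (R / dist x p) := by
    have := mul_le_mul_of_nonneg_left h1 (show 0 ≤ √lam * R by positivity)
    linarith
  refine le_trans ?_ h5
  rcases le_total R (2 * r) with hc | hc
  · have h6 : √lam * R * (t / r) ≤ √lam * (2 * r) * (t / r) := by gcongr
    have h7 : √lam * (2 * r) * (t / r) = t * (2 * √lam) := by field_simp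
    linarith
  · have h6 : 1 / 2 ≤ Real.log (R / r) := by
      have h7 : Real.log 2 ≤ Real.log (R / r) :=
        Real.log_le_log (by norm_num) (by rwa [le_div_iff₀ hr])
      linarith [Real.log_two_gt_d9]
    have h8 : √lam * R ≤ 2 * G := by
      have : √lam * R * (1 / 2) ≤ √lam * R * Real.log (R / r) := by gcongr
      linarith
    have h9 : t / r ≤ 1 / 4 := by
      rw [div_le_iff₀ hr]
      linarith
    have h10 : √lam * R * (t / r) ≤ 2 * G * (1 / 4) := by gcongr
    linarith

end LogSupersolution

section InteriorRegularity

variable {D : Set Plane} {f g h v : Plane → ℝ} {x : Plane}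

theorem hasDerivAt_log_radial {x z : Plane} {κ R : ℝ} (hR : 0 < R) (hz : dist z x = R) :
    HasDerivAt (fun t : ℝ => κ * Real.log (R / dist (z + t • (-(R⁻¹ • (z - x)))) x)) (κ / R) 0 := by
  have h1 : ∀ t : ℝ, κ * Real.log (R / dist (z + t • (-(R⁻¹ • (z - x)))) x) =
      κ * -Real.log (1 - t * R⁻¹) := by
    intro t
    have h2 : z + t • (-(R⁻¹ • (z - x))) - x = (1 - t * R⁻¹) • (z - x) := by module
    rw [dist_eq_norm] at hz
    rw [dist_eq_norm, h2, norm_smul, hz, Real.norm_eq_abs, ← Real.log_abs (1 - t * R⁻¹),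
      ← Real.log_inv]
    congr 2
    rw [div_mul_eq_div_div_swap, div_self hR.ne', one_div]
  simp_rw [h1]
  have h3 : HasDerivAt (fun t : ℝ => 1 - t * R⁻¹) (-R⁻¹) 0 := by
    simpa using ((hasDerivAt_id (0 : ℝ)).mul_const R⁻¹).const_sub 1
  have h4 := ((h3.log (by simp)).neg).const_mul κ
  simpa [div_eq_mul_inv] using h4

/-- Enlarging a competitor by a steep logarithmic profile around a disc on which it is large. -/
theorem Admissible.exists_glue (hD : IsOpen D) (hv : Admissible D f g h v) {ρ R κ : ℝ}
    (hρ : 0 < ρ) (hρR : ρ < R) (hκ : 0 < κ) (hball : closedBall x ρ ⊆ (closure D)ᶜ)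
    (hbig : ∀ z ∈ closedBall x ρ, κ * Real.log (R / ρ) < v z)
    (hbd : ∀ z ∈ frontier D, κ * Real.log (R / dist z x) ≤ g z)
    (hvpos : ∀ z ∈ frontier D, 0 < v z) (hh0 : ∀ z, 0 ≤ h z)
    (hh : HarmonicOnNhd h (closedBall x R)) (hf : ∀ z, √(f z) ≤ κ / R) :
    ∃ w, Admissible D f g h w ∧ ∀ z ∉ D, ρ < dist z x → dist z x < R → 0 < w z := by
  have hR : 0 < R := hρ.trans hρR
  have hballD : closedBall x ρ ⊆ Dᶜ := fun z hz h => hball hz (subset_closure h)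
  set ω : Plane → ℝ := fun z => κ * Real.log (R / max ρ (dist z x)) with hω
  have hmaxpos : ∀ z, 0 < max ρ (dist z x) := fun z => lt_max_of_lt_left hρ
  have hωc : Continuous ω := by
    refine continuous_const.mul (Continuous.log ?_ fun z => ?_)
    · exact continuous_const.div (by fun_prop) fun z => (hmaxpos z).ne'
    · exact (div_pos hR (hmaxpos z)).ne'
  have hωin : ∀ z ∈ closedBall x ρ, ω z < v z := fun z hz => by
    have : max ρ (dist z x) = ρ := max_eq_left hz
    simp only [hω, this]
    exact hbig z hz
  have hωout : ∀ z, ρ < dist z x → ω z = κ * Real.log (R / dist z x) := fun z hz => by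
    simp only [hω, max_eq_right hz.le]
  have hωfar : ∀ z, R ≤ dist z x → ω z ≤ 0 := fun z hz => by
    rw [hωout z (hρR.trans_le hz)]
    refine mul_nonpos_of_nonneg_of_nonpos hκ.le (Real.log_nonpos (by positivity) ?_)
    rwa [div_le_one (hR.trans_le hz)]
  have hωpos : ∀ z, dist z x < R → 0 < ω z := fun z hz =>
    mul_pos hκ (Real.log_pos ((one_lt_div (hmaxpos z)).2 (max_lt hρR hz)))
  have hev : ∀ z, ρ < dist z x → ω =ᶠ[𝓝 z] fun y => κ * Real.log (R / dist y x) := fun z hz => by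
    have hc : Continuous fun y : Plane => dist y x := by fun_prop
    filter_upwards [hc.continuousAt.eventually (lt_mem_nhds hz)] with y hy using hωout y hy
  have hωharm : ∀ z, ρ < dist z x → HarmonicAt ω z := fun z hz => by
    have hzx : z ≠ x := dist_pos.1 (hρ.trans hz)
    have h1 : HarmonicAt ((fun _ => κ * Real.log R) - κ • fun y => Real.log (dist y x)) z :=
      (harmonicAt_const _).sub (harmonicAt_log_dist hzx).const_smul
    refine (harmonicAt_congr_nhds ((hev z hz).trans ?_)).2 h1
    filter_upwards [isOpen_compl_singleton.mem_nhds hzx] with y hy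
    have hy0 : dist y x ≠ 0 := dist_ne_zero.2 hy
    simp only [Pi.sub_apply, Pi.smul_apply, smul_eq_mul]
    rw [Real.log_div hR.ne' hy0]
    ring
  have hωh : ∀ z ∉ D, ω z ≤ h z := by
    intro z hz
    rcases le_or_gt (dist z x) ρ with h1 | h1
    · exact (hωin z h1).le.trans (hv.2 z hz)
    rcases le_or_gt R (dist z x) with h2 | h2
    · exact (hωfar z h2).trans (hh0 z)
    set U := ball x R \ closedBall x ρ with hU
    have hUo : IsOpen U := isOpen_ball.sdiff isClosed_closedBall
    have hUcl : closure U ⊆ closedBall x R ∩ {y | ρ ≤ dist y x} := by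
      refine closure_minimal (fun y hy => ⟨ball_subset_closedBall hy.1, ?_⟩)
        (isClosed_closedBall.inter (isClosed_le continuous_const (by fun_prop)))
      have : ρ < dist y x := by simpa using hy.2
      exact this.le
    have hzU : z ∈ U := ⟨h2, by simpa using h1⟩
    refine le_of_viscSubAt hUo (isBounded_ball.subset sdiff_subset) (v := ω) (H := h)
      hωc.continuousOn (hh.continuousOn.mono (hUcl.trans inter_subset_left))
      (hh.mono (sdiff_subset.trans ball_subset_closedBall))
      (fun y hy _ => viscSubAt_of_harmonicAt (hωharm y (by simpa using hy.2))) ?_ z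
      (subset_closure hzU)
    intro y hy
    have hyU : y ∉ U := fun h => hy.2 (by rwa [hUo.interior_eq])
    have hy2 : ρ ≤ dist y x := (hUcl hy.1).2
    rcases hy2.eq_or_lt with h3 | h3
    · have hyb : y ∈ closedBall x ρ := h3.ge
      exact (hωin y hyb).le.trans (hv.2 y (hballD hyb))
    · have h4 : R ≤ dist y x := by
        by_contra! hlt
        exact hyU ⟨hlt, by simpa using h3⟩
      exact (hωfar y h4).trans (hh0 y)
  set w : Plane → ℝ := fun z => max (v z) (ω z) with hw
  have hvw : ∀ z, v z ≤ w z := fun z => le_max_left _ _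
  have hωw : ∀ z, ω z ≤ w z := fun z => le_max_right _ _
  have hwc : ContinuousOn w Dᶜ := ContinuousOn.sup hv.1.continuousOn hωc.continuousOn
  refine ⟨w, ⟨⟨hwc, fun z hz => (hv.1.nonneg z hz).trans (hvw z), ?_, ?_, ?_⟩, ?_⟩, ?_⟩
  · intro z hz hzD
    rcases le_or_gt (ω z) (v z) with hle | hlt
    · refine (hv.1.viscSubAt hzD ?_).of_le (Eventually.of_forall hvw) (max_eq_left hle).symm
      have := hz.2
      simpa only [hw, max_eq_left hle] using this
    · have hzρ : ρ < dist z x := by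
        by_contra! hle
        exact lt_asymm hlt (hωin z hle)
      exact (viscSubAt_of_harmonicAt (hωharm z hzρ)).of_le (Eventually.of_forall hωw)
        (max_eq_right hlt.le).symm
  · intro z hz
    have hzρ : ρ < dist z x := by
      by_contra! hle
      exact hball hle hz.1
    refine max_le (hv.1.le_boundary z hz) ?_
    rw [hωout z hzρ]
    exact hbd z hz
  · intro z hz
    have h0 : w z = 0 :=
      le_antisymm (nonpos_of_mem_freeBoundary (eventually_pos_of_pos hwc hz.1.1) hz)
        ((hv.1.nonneg z hz.1.1).trans (hvw z))
    have hzD : z ∉ closure D := fun hcl => by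
      have hzf : z ∈ frontier D := ⟨hcl, by rw [hD.interior_eq]; exact hz.1.1⟩
      linarith [hvpos z hzf, hvw z]
    have hsub : posSet D w ⊆ posSet D v ∪ {y | 0 < ω y} := by
      rintro y ⟨hyD, hy⟩
      rcases lt_max_iff.1 hy with hy | hy
      · exact Or.inl ⟨hyD, hy⟩
      · exact Or.inr hy
    have hcl := closure_mono hsub hz.1.2
    rw [closure_union] at hcl
    rcases hcl with hcl | hcl
    · exact hv.1.subFBAt_of_le (fun y _ => hvw y) hz.1.1 h0 hcl
    · have hsub0 : {y | 0 < ω y} ⊆ {y | 0 ≤ ω y} := fun y hy =>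
        show 0 ≤ ω y from le_of_lt hy
      have hω0 : 0 ≤ ω z := closure_minimal hsub0 (isClosed_le continuous_const hωc) hcl
      have hωz : ω z = 0 := le_antisymm ((hωw z).trans h0.le) hω0
      have hzR : dist z x = R := by
        refine le_antisymm ?_ ?_
        · have hmem : {y | 0 < ω y} ⊆ closedBall x R := fun y hy => by
            by_contra hn
            have : R < dist y x := by simpa using hn
            exact absurd (hωfar y this.le) (not_le.2 hy)
          exact closure_minimal hmem isClosed_closedBall hcl
        · by_contra! hlt
          linarith [hωpos z hlt]
      have hzρ : ρ < dist z x := by rwa [hzR]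
      refine subFBAt_of_slope (L := fun y => κ * Real.log (R / dist y x))
        (e := -(R⁻¹ • (z - x))) hzD ?_ ?_ ?_ (div_pos hκ hR) (hf z) (hasDerivAt_log_radial hR hzR)
      · filter_upwards [hev z hzρ] with y hy
        rw [← hy]
        exact hωw y
      · rw [← hωout z hzρ, hωz]
      · rw [norm_neg, norm_smul, ← dist_eq_norm, hzR, norm_inv, Real.norm_of_nonneg hR.le,
          inv_mul_cancel₀ hR.ne']
  · intro z hz
    exact max_le (hv.2 z hz) (hωh z hz)
  · intro z _ _ hzR
    exact (hωpos z hzR).trans_le (hωw z)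

/-- A connected set off `D` that meets `Ω(u)` but not the free boundary lies in `Ω(u)`. -/
theorem IsPreconnected.subset_posSet {u : Plane → ℝ} {A : Set Plane} (hA : IsPreconnected A)
    (hD : IsOpen D) (hlsc : ∀ y ∉ D, 0 < u y → ∀ᶠ z in 𝓝[Dᶜ] y, 0 < u z) (hAD : A ⊆ Dᶜ)
    (hne : (A ∩ posSet D u).Nonempty) (hF : ∀ y ∈ A, y ∉ freeBoundary D u)
    (hcl : ∀ y ∈ A, y ∈ closure D → 0 < u y) : A ⊆ posSet D u := by
  have hopen : IsOpen (D ∪ posSet D u) := by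
    rw [isOpen_iff_mem_nhds]
    rintro y (hy | hy)
    · filter_upwards [hD.mem_nhds hy] with z hz using Or.inl hz
    · have h1 := eventually_nhdsWithin_iff.1 (hlsc y hy.1 hy.2)
      filter_upwards [h1] with z hz
      by_cases hzD : z ∈ D
      · exact Or.inl hzD
      · exact Or.inr ⟨hzD, hz hzD⟩
  have hsub : A ⊆ D ∪ posSet D u := by
    refine hA.subset_of_closure_inter_subset hopen
      (hne.mono (inter_subset_inter_right _ subset_union_right)) ?_
    rintro y ⟨hycl, hy⟩
    refine Or.inr ⟨hAD hy, ?_⟩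
    rw [closure_union] at hycl
    rcases hycl with hycl | hycl
    · exact hcl y hy hycl
    · by_contra! hle
      exact hF y hy (mem_freeBoundary_of_nonpos (hAD hy) hle hycl)
  exact fun y hy => (hsub hy).resolve_left (hAD hy)

theorem notMem_closure_of_infDist_pos {y : Plane} (hy : 0 < infDist y D) : y ∉ closure D :=
  fun h => by rw [infDist_eq_zero_of_mem_closure' h] at hy; exact lt_irrefl _ hy

theorem infDist_pos_of_mem_ball {d : ℝ} (hdD : d ≤ infDist x D) {y : Plane} (hy : y ∈ ball x d) :
    0 < infDist y D := by
  have h1 := infDist_le_infDist_add_dist (s := D) (x := x) (y := y)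
  rw [mem_ball, dist_comm] at hy
  linarith

theorem ball_subset_posSet {u : Plane → ℝ} {d : ℝ} (hD : IsOpen D)
    (hlsc : ∀ y ∉ D, 0 < u y → ∀ᶠ z in 𝓝[Dᶜ] y, 0 < u z) (hx : x ∈ posSet D u) (hd : 0 < d)
    (hdD : d ≤ infDist x D) (hdF : d ≤ infDist x (freeBoundary D u)) :
    ball x d ⊆ posSet D u := by
  have hcl : ∀ y ∈ ball x d, y ∉ closure D := fun y hy =>
    notMem_closure_of_infDist_pos (infDist_pos_of_mem_ball hdD hy)
  refine IsPreconnected.subset_posSet (convex_ball x d).isPreconnected hD hlsc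
    (fun y hy h => hcl y hy (subset_closure h)) ⟨x, mem_ball_self hd, hx⟩ ?_
    (fun y hy h => absurd h (hcl y hy))
  intro y hy hyF
  have h1 := infDist_le_dist_of_mem (x := x) hyF
  rw [mem_ball, dist_comm] at hy
  linarith

end InteriorRegularity

section LargestSubsolution

variable {D : Set Plane} {f g h : Plane → ℝ} {x : Plane}

theorem notMem_freeBoundary_largest (hg : ∀ x ∈ frontier D, 0 < g x) (hh : IsUpperBarrier D h)
    (hx : 0 < largestSubsolution D f g h x) :
    x ∉ freeBoundary D (largestSubsolution D f g h) := fun hF => by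
  rw [largest_eq_zero_of_mem_freeBoundary hg hh hF] at hx
  exact lt_irrefl _ hx

/-- Linear growth of the largest subsolution away from its free boundary. -/
theorem largest_le_mul_infDist {lam Lam r G gm : ℝ} {p : Plane} {W : Plane → ℝ} (hD : IsOpen D)
    (hlam : 0 < lam) (hLam : lam < Lam) (hr : 0 < r) (hG : 0 < G) (hp : p ∈ D) (hgm : 0 < gm)
    (hg : ∀ x ∈ frontier D, gm ≤ g x) (hf : ∀ x, √(f x) ≤ √Lam)
    (hW : Admissible D f g (logSupersolution lam p r G) W) (hWpos : ∀ z ∈ frontier D, 0 < W z)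
    (hne : (freeBoundary D (largestSubsolution D f g (logSupersolution lam p r G))).Nonempty)
    (hx : x ∈ posSet D (largestSubsolution D f g (logSupersolution lam p r G)))
    (hd : infDist x (freeBoundary D (largestSubsolution D f g (logSupersolution lam p r G))) ≤
      infDist x D) :
    largestSubsolution D f g (logSupersolution lam p r G) x ≤
      40 * √Lam *
        infDist x (freeBoundary D (largestSubsolution D f g (logSupersolution lam p r G))) := by
  have hg0 : ∀ x ∈ frontier D, 0 < g x := fun x hx => hgm.trans_le (hg x hx)
  have hh := isUpperBarrier_logSupersolution (D := D) hlam hr hG hp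
  set h := logSupersolution lam p r G with hhdef
  set u := largestSubsolution D f g h with hu
  set d := infDist x (freeBoundary D u) with hddef
  have hFc : IsClosed (freeBoundary D u) := isClosed_freeBoundary hD
  have hd0 : 0 < d := (hFc.notMem_iff_infDist_pos hne).1 (notMem_freeBoundary_largest hg0 hh hx.2)
  obtain ⟨y, hyF, hyd⟩ := hFc.exists_infDist_eq_dist hne x
  have hyx : dist y x = d := by rw [dist_comm, ← hyd]
  have hlsc : ∀ y ∉ D, 0 < u y → ∀ᶠ z in 𝓝[Dᶜ] y, 0 < u z := fun y hy hpos =>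
    eventually_lt_largest hg0 hh hy hpos
  have hball := ball_subset_posSet hD hlsc hx hd0 hd le_rfl
  have hbcl : ∀ z ∈ ball x d, z ∉ closure D := fun z hz =>
    notMem_closure_of_infDist_pos (infDist_pos_of_mem_ball hd hz)
  have hharm : HarmonicOnNhd u (ball x d) := fun z hz =>
    harmonicAt_largest hD hg0 hh (hbcl z hz) (hball hz).2
  have hsl : 0 < √Lam := Real.sqrt_pos.2 (hlam.trans hLam)
  have hdD : ∀ z ∈ closure D, d ≤ dist x z := fun z hz => by
    have h1 := infDist_le_dist_of_mem (x := x) hz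
    rw [infDist_closure] at h1
    exact hd.trans h1
  by_contra! hlt
  rcases le_or_gt (outerRadius lam r G) (dist x p + d) with hcase | hcase
  · have h1 := logSupersolution_le_of_near hlam hr hG hd0 (hdD p (subset_closure hp)) hcase
    have h2 : u x ≤ h x := largest_le hg0 hh hx.1
    have h3 : √lam ≤ √Lam := Real.sqrt_le_sqrt hLam.le
    have h4 : 2 * √lam * d ≤ 40 * √Lam * d := by
      gcongr
      linarith
    linarith
  have hdp : d < dist x p := by
    refine lt_of_le_of_ne (hdD p (subset_closure hp)) fun heq => ?_
    have hpc : p ∈ closure (ball x d) := by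
      rw [closure_ball x hd0.ne', mem_closedBall, dist_comm, heq]
    obtain ⟨z, hzD, hzb⟩ := mem_closure_iff.1 hpc D hD hp
    exact hbcl z hzb (subset_closure hzD)
  set m := u x / 10 with hm
  have hm0 : 0 < m := by have := hx.2; positivity
  obtain ⟨η, hη0, hη1, hη2, hη3, hη4⟩ : ∃ η, 0 < η ∧ η ≤ d ∧ 2 * m * (η / d) ≤ gm ∧
      dist x p + (d + η) < outerRadius lam r G ∧ d + η < dist x p := by
    refine ⟨min (min d (gm * d / (2 * m))) (min ((outerRadius lam r G - dist x p - d) / 2)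
      ((dist x p - d) / 2)), ?_, (min_le_left _ _).trans (min_le_left _ _), ?_, ?_, ?_⟩
    · refine lt_min (lt_min hd0 (by positivity)) (lt_min ?_ ?_) <;> linarith
    · have h1 := (min_le_left (min d (gm * d / (2 * m)))
        (min ((outerRadius lam r G - dist x p - d) / 2) ((dist x p - d) / 2))).trans
        (min_le_right _ _)
      rw [le_div_iff₀ (by positivity)] at h1
      rw [← mul_div_assoc, div_le_iff₀ hd0]
      linarith
    · have h1 := (min_le_right (min d (gm * d / (2 * m)))
        (min ((outerRadius lam r G - dist x p - d) / 2) ((dist x p - d) / 2))).trans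
        (min_le_left _ _)
      linarith
    · have h1 := (min_le_right (min d (gm * d / (2 * m)))
        (min ((outerRadius lam r G - dist x p - d) / 2) ((dist x p - d) / 2))).trans
        (min_le_right _ _)
      linarith
  set R := d + η with hR
  have hR0 : 0 < R := by positivity
  have hlog1 : 1 / 2 ≤ Real.log (R / (d / 2)) := by
    have h1 : Real.log 2 ≤ Real.log (R / (d / 2)) :=
      Real.log_le_log (by norm_num) (by rw [le_div_iff₀ (by positivity)]; linarith)
    linarith [Real.log_two_gt_d9]
  have hlog2 : Real.log (R / (d / 2)) ≤ 7 / 5 := by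
    have h1 : Real.log (R / (d / 2)) ≤ Real.log (2 ^ 2) :=
      Real.log_le_log (by positivity) (by rw [div_le_iff₀ (by positivity)]; linarith)
    rw [Real.log_pow] at h1
    push_cast at h1
    linarith [Real.log_two_lt_d9]
  have hlog0 : 0 < Real.log (R / (d / 2)) := by linarith
  set κ := m / Real.log (R / (d / 2)) with hκ
  have hκ0 : 0 < κ := by positivity
  have hκ1 : κ ≤ 2 * m := by
    rw [hκ, div_le_iff₀ hlog0]
    nlinarith
  have hκ2 : √Lam ≤ κ / R := by
    have h1 : m * (5 / 7) ≤ κ := by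
      rw [hκ, le_div_iff₀ hlog0]
      nlinarith
    rw [le_div_iff₀ hR0]
    have h2 : √Lam * R ≤ √Lam * (2 * d) := by gcongr; linarith
    nlinarith
  have hinner : closedBall x (d / 2) ⊆ ball x d := closedBall_subset_ball (by linarith)
  obtain ⟨v₁, hv₁, hv₁big⟩ := exists_admissible_lt_on_compact (f := f) hg0 hh (c := m)
    (isCompact_closedBall x (d / 2)) (fun z hz => (hball (hinner hz)).1) (fun z hz => by
      have h1 := harnack_half hd0 hharm (fun z hz => (hball hz).2.le) hz
      have := hx.2
      change m < u z
      linarith)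
  obtain ⟨w, hw, hwpos⟩ := (hv₁.sup hW).exists_glue hD (x := x) (ρ := d / 2) (R := R) (κ := κ)
    (by positivity) (by linarith) hκ0 (fun z hz => hbcl z (hinner hz))
    (fun z hz => by
      rw [hκ, div_mul_cancel₀ _ hlog0.ne']
      exact lt_max_of_lt_left (hv₁big z hz))
    (fun z hz => by
      have hzd : d ≤ dist z x := by rw [dist_comm]; exact hdD z hz.1
      have h1 : Real.log (R / dist z x) ≤ η / d := by
        have h2 : Real.log (R / dist z x) ≤ Real.log (R / d) :=
          Real.log_le_log (div_pos hR0 (hd0.trans_le hzd)) (by gcongr)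
        have h3 := Real.log_le_sub_one_of_pos (show 0 < R / d by positivity)
        have h4 : R / d - 1 = η / d := by
          rw [hR]
          field_simp
          ring
        linarith
      have h5 : κ * Real.log (R / dist z x) ≤ κ * (η / d) := by gcongr
      have h6 : κ * (η / d) ≤ 2 * m * (η / d) := by gcongr
      linarith [hg z hz])
    (fun z hz => lt_max_of_lt_right (hWpos z hz)) hh.nonneg
    (fun z hz => by
      have hz' : dist z x ≤ R := hz
      refine harmonicAt_logSupersolution hlam hr hG ?_ ?_
      · rintro rfl
        rw [dist_comm] at hz'
        linarith
      · linarith [dist_triangle z x p])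
    (fun z => (hf z).trans hκ2)
  have h1 := hwpos y hyF.1.1 (by rw [hyx]; linarith) (by rw [hyx]; linarith)
  have h2 := hw.le_largest hyF.1.1
  have h3 : u y = 0 := largest_eq_zero_of_mem_freeBoundary hg0 hh hyF
  rw [← hu, h3] at h2
  linarith

theorem le_add_of_deriv_le_of_pos {φ : ℝ → ℝ} {L : ℝ} (hL : 0 ≤ L) (hc : ContinuousOn φ (Icc 0 1))
    (h0 : 0 ≤ φ 0)
    (hd : ∀ t ∈ Ioo (0 : ℝ) 1, 0 < φ t → DifferentiableAt ℝ φ t ∧ deriv φ t ≤ L) :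
    φ 1 ≤ φ 0 + L := by
  have hA : IsCompact (Icc (0 : ℝ) 1 ∩ φ ⁻¹' Iic (φ 0)) :=
    isCompact_Icc.of_isClosed_subset (hc.preimage_isClosed_of_isClosed isClosed_Icc isClosed_Iic)
      inter_subset_left
  obtain ⟨s, ⟨hs1, hs2⟩, hmax⟩ := hA.exists_isGreatest ⟨0, by simp⟩
  have hs2' : φ s ≤ φ 0 := hs2
  rcases hs1.2.eq_or_lt with rfl | hlt
  · linarith
  have hpos : ∀ t ∈ Ioo s 1, 0 < φ t := fun t ht => by
    by_contra! hle
    have := hmax ⟨⟨hs1.1.trans ht.1.le, ht.2.le⟩, show φ t ≤ φ 0 by linarith⟩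
    linarith [ht.1]
  have hmem : ∀ t ∈ Ioo s 1, t ∈ Ioo (0 : ℝ) 1 := fun t ht => ⟨hs1.1.trans_lt ht.1, ht.2⟩
  obtain ⟨c, hcm, hceq⟩ := exists_deriv_eq_slope φ hlt (hc.mono (Icc_subset_Icc_left hs1.1))
    (fun t ht => (hd t (hmem t ht) (hpos t ht)).1.differentiableWithinAt)
  have h1 := (hd c (hmem c hcm) (hpos c hcm)).2
  rw [hceq, div_le_iff₀ (by linarith)] at h1
  nlinarith [hs1.1]

/-- A function with linear growth away from its free boundary is continuous off `closure D`. -/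
theorem continuousAt_of_linear_growth {u : Plane → ℝ} {c : ℝ} (hx : x ∉ closure D)
    (hnn : ∀ y ∉ D, 0 ≤ u y) (hpos : 0 < u x → ContinuousAt u x) (hc : 0 ≤ c)
    (hgrow : ∀ y ∈ posSet D u, infDist y (freeBoundary D u) ≤ infDist y D →
      u y ≤ c * infDist y (freeBoundary D u)) (hDne : D.Nonempty) : ContinuousAt u x := by
  have hxD : x ∉ D := fun h => hx (subset_closure h)
  rcases (hnn x hxD).eq_or_lt with h0 | h0
  swap
  · exact hpos h0
  have hevD := eventually_compl_of_notMem_closure hx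
  by_cases hcl : x ∈ closure (posSet D u)
  · have hxF := mem_freeBoundary_of_nonpos hxD h0.ge hcl
    have hdx : 0 < infDist x D := by
      have := (isClosed_closure.notMem_iff_infDist_pos hDne.closure).1 hx
      rwa [infDist_closure] at this
    have hlim : Tendsto (fun y => c * dist y x) (𝓝 x) (𝓝 0) := by
      have : Continuous fun y => c * dist y x := by fun_prop
      simpa using this.tendsto x
    rw [ContinuousAt, ← h0]
    refine tendsto_of_tendsto_of_tendsto_of_le_of_le' tendsto_const_nhds hlim ?_ ?_
    · filter_upwards [hevD] with y hy using hnn y hy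
    · filter_upwards [hevD, ball_mem_nhds x (half_pos hdx)] with y hy hyb
      have hyb' : dist y x < infDist x D / 2 := hyb
      rcases (hnn y hy).eq_or_lt with hy0 | hy0
      · rw [← hy0]
        positivity
      · have h1 := infDist_le_dist_of_mem (x := y) hxF
        have h2 := infDist_le_infDist_add_dist (s := D) (x := x) (y := y)
        rw [dist_comm x y] at h2
        refine (hgrow y ⟨hy, hy0⟩ (by linarith)).trans ?_
        gcongr
  · have hev : u =ᶠ[𝓝 x] fun _ => 0 := by
      filter_upwards [hevD, isClosed_closure.isOpen_compl.mem_nhds hcl] with y hy hyc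
      by_contra hne
      exact hyc (subset_closure ⟨hy, lt_of_le_of_ne (hnn y hy) (Ne.symm hne)⟩)
    exact hev.continuousAt

theorem freeBoundary_nonempty {u : Plane → ℝ} (hD : IsOpen D) (hb : Bornology.IsBounded D)
    {p : Plane} (hp : p ∈ D) (hlsc : ∀ y ∉ D, 0 < u y → ∀ᶠ z in 𝓝[Dᶜ] y, 0 < u z)
    (hpos : ∀ y ∈ frontier D, 0 < u y) {R : ℝ} (hR : ∀ y ∉ D, R ≤ dist y p → u y = 0) :
    (freeBoundary D u).Nonempty := by
  by_contra hemp
  rw [not_nonempty_iff_eq_empty] at hemp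
  obtain ⟨x₀, hx₀, hmax⟩ := hb.isCompact_closure.exists_isMaxOn ⟨p, subset_closure hp⟩
    (f := fun y => dist y p) (by fun_prop)
  have hmax' : ∀ y ∈ closure D, dist y p ≤ dist x₀ p := fun y hy => hmax hy
  have hx₀p : 0 < dist x₀ p := by
    obtain ⟨η, hη, hηD⟩ := Metric.isOpen_iff.1 hD p hp
    obtain ⟨v, hv⟩ : ∃ v : Plane, ‖v‖ = η / 2 := exists_norm_eq Plane (by positivity)
    have h1 := hmax' (p + v) (subset_closure (hηD (by
      rw [mem_ball, dist_self_add_left, hv]; linarith)))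
    rw [dist_self_add_left, hv] at h1
    linarith
  have hγd : ∀ t : ℝ, 0 ≤ t → dist (x₀ + t • (x₀ - p)) p = (1 + t) * dist x₀ p := fun t ht => by
    have : x₀ + t • (x₀ - p) - p = (1 + t) • (x₀ - p) := by module
    rw [dist_eq_norm, this, norm_smul, Real.norm_of_nonneg (by linarith), ← dist_eq_norm]
  have hout : ∀ t : ℝ, 0 < t → x₀ + t • (x₀ - p) ∉ closure D := fun t ht hmem => by
    have h1 := hmax' _ hmem
    rw [hγd t ht.le] at h1
    nlinarith
  have hcγ : Continuous fun t : ℝ => x₀ + t • (x₀ - p) := by fun_prop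
  have hx₀D : x₀ ∉ D := fun hmem => by
    have h1 : ∀ᶠ t in 𝓝[>] (0 : ℝ), x₀ + t • (x₀ - p) ∈ D := by
      have := hcγ.tendsto 0
      simp only [zero_smul, add_zero] at this
      exact (this.mono_left nhdsWithin_le_nhds).eventually (hD.mem_nhds hmem)
    obtain ⟨t, ht1, ht2⟩ := (h1.and self_mem_nhdsWithin).exists
    exact hout t ht2 (subset_closure ht1)
  have hx₀f : x₀ ∈ frontier D := ⟨hx₀, by rwa [hD.interior_eq]⟩
  have hAD : (fun t : ℝ => x₀ + t • (x₀ - p)) '' Ici 0 ⊆ Dᶜ := by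
    rintro _ ⟨t, ht, rfl⟩
    rcases (mem_Ici.1 ht).eq_or_lt with h0 | h0
    · simpa [← h0] using hx₀D
    · exact fun h => hout t h0 (subset_closure h)
  have hsub := IsPreconnected.subset_posSet (u := u) (isPreconnected_Ici.image _ hcγ.continuousOn) hD
    hlsc hAD ⟨x₀, ⟨0, by simp, by simp⟩, hx₀D, hpos x₀ hx₀f⟩ (by simp [hemp])
    (fun y hy hycl => hpos y ⟨hycl, by rw [hD.interior_eq]; exact hAD hy⟩)
  have hT : 0 ≤ |R| / dist x₀ p := by positivity
  have hmem := hsub ⟨|R| / dist x₀ p, hT, rfl⟩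
  have h0 := hR _ hmem.1 (by
    simp only
    rw [hγd _ hT, add_mul, div_mul_cancel₀ _ hx₀p.ne']
    linarith [le_abs_self R])
  exact hmem.2.ne' h0

theorem norm_fderiv_largest_le (hD : IsOpen D) (hg : ∀ x ∈ frontier D, 0 < g x)
    (hh : IsUpperBarrier D h) {d : ℝ} (hd : 0 < d)
    (hx : x ∈ posSet D (largestSubsolution D f g h)) (hdD : d ≤ infDist x D)
    (hdF : d ≤ infDist x (freeBoundary D (largestSubsolution D f g h))) :
    ‖fderiv ℝ (largestSubsolution D f g h) x‖ ≤ 8 * largestSubsolution D f g h x / d := by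
  have hball := ball_subset_posSet hD (fun y hy hpos => eventually_lt_largest hg hh hy hpos) hx hd
    hdD hdF
  exact norm_fderiv_le_of_harmonic hd (fun z hz => harmonicAt_largest hD hg hh
    (notMem_closure_of_infDist_pos (infDist_pos_of_mem_ball hdD hz)) (hball hz).2)
    (fun z hz => (hball hz).2.le)

/-- A Lipschitz bound along a segment for a continuous function whose gradient is controlled only
where it is positive. -/
theorem le_add_mul_dist_of_fderiv_le {u : Plane → ℝ} {L : ℝ} {x y : Plane} (hL : 0 ≤ L)
    (hy : 0 ≤ u y) (hc : ∀ z ∈ segment ℝ y x, ContinuousAt u z)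
    (hd : ∀ z ∈ segment ℝ y x, 0 < u z → DifferentiableAt ℝ u z ∧ ‖fderiv ℝ u z‖ ≤ L) :
    u x ≤ u y + L * dist x y := by
  have hmem : ∀ t ∈ Icc (0 : ℝ) 1, y + t • (x - y) ∈ segment ℝ y x := fun t ht => by
    rw [segment_eq_image']
    exact ⟨t, ht, rfl⟩
  have hline : ∀ t : ℝ, HasDerivAt (fun t : ℝ => y + t • (x - y)) (x - y) t := fun t => by
    simpa using ((hasDerivAt_id t).smul_const (x - y)).const_add y
  have := le_add_of_deriv_le_of_pos (φ := fun t => u (y + t • (x - y))) (L := L * dist x y)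
    (by positivity) ?_ (by simpa using hy) ?_
  · simpa using this
  · intro t ht
    exact (ContinuousAt.comp (f := fun t : ℝ => y + t • (x - y)) (hc _ (hmem t ht))
      (hline t).continuousAt).continuousWithinAt
  · intro t ht hpos
    obtain ⟨h1, h2⟩ := hd _ (hmem t ⟨ht.1.le, ht.2.le⟩) hpos
    have h3 : HasDerivAt (fun t => u (y + t • (x - y))) (fderiv ℝ u (y + t • (x - y)) (x - y)) t :=
      h1.hasFDerivAt.comp_hasDerivAt t (hline t)
    refine ⟨h3.differentiableAt, ?_⟩
    rw [h3.deriv, dist_eq_norm]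
    have h4 := (fderiv ℝ u (y + t • (x - y))).le_opNorm (x - y)
    rw [Real.norm_eq_abs] at h4
    refine (le_abs_self _).trans (h4.trans ?_)
    gcongr

end LargestSubsolution

end OnePhase

end

theorem theorem3p1 :
    ∃ C : ℝ, 0 < C ∧
      ∀ (D : Set OnePhase.Plane) (g : OnePhase.Plane → ℝ) (lam Lam : ℝ),
        IsOpen D → IsConnected D → Bornology.IsBounded D →
        ContinuousOn g (frontier D) → (∀ x ∈ frontier D, 0 < g x) → 0 < lam →
        ∃ K : ℝ, 0 < K ∧
          ∀ (f : OnePhase.Plane → ℝ) (p : OnePhase.Plane) (r G : ℝ) (u : OnePhase.Plane → ℝ),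
            Continuous f → (∀ x, lam < f x ∧ f x < Lam) →
            p ∈ D → D ⊆ Metric.ball p r → (∀ x ∈ frontier D, g x ≤ G) →
            u = OnePhase.largestSubsolution D f g (OnePhase.logSupersolution lam p r G) →
            (∀ x ∈ OnePhase.posSet D u,
              u x ≤ K * Metric.infDist x (OnePhase.freeBoundary D u)) ∧
            (∀ x ∈ OnePhase.posSet D u,
              Metric.infDist x (OnePhase.freeBoundary D u) ≤ Metric.infDist x D →
              u x ≤ C * √Lam * Metric.infDist x (OnePhase.freeBoundary D u)) ∧
            (∀ x ∈ OnePhase.posSet D u, x ∉ closure D → DifferentiableAt ℝ u x ∧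
              (Metric.infDist x (OnePhase.freeBoundary D u) ≤ Metric.infDist x D →
                ‖fderiv ℝ u x‖ ≤ C * √Lam)) ∧
            (∀ δ : ℝ, 0 < δ →
              LipschitzOnWith (Real.toNNReal (C * max (√Lam) (G / δ))) u
                {x | δ ≤ Metric.infDist x D}) := by
  refine ⟨320, by norm_num, fun D g lam Lam hD hconn hb hgc hgpos hlam => ?_⟩
  obtain ⟨a₀, ha₀⟩ := hconn.nonempty
  obtain ⟨ρ₀, hρ₀, hρ₀D⟩ := Metric.isOpen_iff.1 hD a₀ ha₀
  have hfc : IsCompact (frontier D) :=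
    hb.isCompact_closure.of_isClosed_subset isClosed_frontier frontier_subset_closure
  have hfne : (frontier D).Nonempty := by
    refine nonempty_frontier_iff.2 ⟨⟨a₀, ha₀⟩, fun huniv => ?_⟩
    rw [huniv] at hb
    exact NormedSpace.unbounded_univ ℝ OnePhase.Plane hb
  obtain ⟨z₁, hz₁, hmin⟩ := hfc.exists_isMinOn hfne hgc
  obtain ⟨z₂, hz₂, hmax⟩ := hfc.exists_isMaxOn hfne hgc
  have hgm : ∀ x ∈ frontier D, g z₁ ≤ g x := fun x hx => hmin hx
  have hgM : ∀ x ∈ frontier D, g x ≤ g z₂ := fun x hx => hmax hx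
  have hg₁ := hgpos z₁ hz₁
  have hg₂ := hgpos z₂ hz₂
  have hsl : 0 < √lam := Real.sqrt_pos.2 hlam
  obtain ⟨δ, hδ0, hδ1, hδ2⟩ : ∃ δ > 0, δ ≤ ρ₀ / 4 ∧ δ * (2 * √lam) ≤ g z₁ / 2 := by
    refine ⟨min (ρ₀ / 4) (g z₁ / 2 / (2 * √lam)), by positivity, min_le_left _ _, ?_⟩
    rw [← le_div_iff₀ (by positivity)]
    exact min_le_right _ _
  obtain ⟨δ₀, hδ₀, W, hW, hWpos⟩ := OnePhase.exists_isLowerBarrier hD hconn hb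
    (m := g z₁ / 2) (σ := √Lam + 1) (δ := δ) (by positivity) (by positivity) hδ0
  refine ⟨40 * √Lam + 2 * g z₂ / δ₀, by positivity, ?_⟩
  intro f p r G u _ hf hp hDr hgG hu
  have hLam : lam < Lam := (hf p).1.trans (hf p).2
  have hsL : 0 < √Lam := Real.sqrt_pos.2 (hlam.trans hLam)
  have hfs : ∀ x, √(f x) ≤ √Lam := fun x => Real.sqrt_le_sqrt (hf x).2.le
  have hG : 0 < G := hg₁.trans_le (hgG z₁ hz₁)
  have hr₀ : ρ₀ ≤ r := OnePhase.le_of_ball_subset_ball hρ₀ (hρ₀D.trans hDr)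
  have hr : 0 < r := hρ₀.trans_le hr₀
  have hh := OnePhase.isUpperBarrier_logSupersolution (D := D) hlam hr hG hp
  have hWadm : OnePhase.Admissible D f g (OnePhase.logSupersolution lam p r G) W := by
    refine hW.admissible hδ₀ hWpos (fun x hx => by linarith [hgm x hx])
      (fun x => by linarith [hfs x]) hD hh.nonneg fun x hx hxδ => ?_
    obtain ⟨y, hy, hxy⟩ := (infDist_lt_iff hconn.nonempty).1 hxδ
    refine OnePhase.le_logSupersolution_of_near hlam hr hG (t := δ) (by linarith [hgG z₁ hz₁]) hδ0
      (by linarith) hδ2 (fun h => hx (h ▸ hp)) ?_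
    have : dist y p < r := hDr hy
    linarith [dist_triangle x y p]
  have hupos : ∀ x ∉ D, infDist x D < δ₀ → 0 < u x := fun x hx hd => by
    rw [hu]
    exact (hWpos x hx hd).trans_le (hWadm.le_largest hx)
  have hfrD : ∀ x ∈ frontier D, x ∉ D := fun x hx h => hx.2 (by rwa [hD.interior_eq])
  have hufr : ∀ x ∈ frontier D, 0 < u x := fun x hx =>
    hupos x (hfrD x hx) (by rwa [OnePhase.infDist_eq_zero_of_mem_closure' hx.1])
  have hWfr : ∀ x ∈ frontier D, 0 < W x := fun x hx =>
    hWpos x (hfrD x hx) (by rwa [OnePhase.infDist_eq_zero_of_mem_closure' hx.1])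
  have hunn : ∀ x ∉ D, 0 ≤ u x := fun x hx => by
    rw [hu]
    exact OnePhase.largest_nonneg hgpos hh hx
  have hlsc : ∀ y ∉ D, 0 < u y → ∀ᶠ z in 𝓝[Dᶜ] y, 0 < u z := fun y hy hpos => by
    rw [hu] at hpos ⊢
    exact OnePhase.eventually_lt_largest hgpos hh hy hpos
  have hne : (OnePhase.freeBoundary D u).Nonempty := by
    refine OnePhase.freeBoundary_nonempty hD hb hp hlsc hufr
      (R := OnePhase.outerRadius lam r G) fun y hy hd => le_antisymm ?_ (hunn y hy)
    rw [hu, ← OnePhase.logSupersolution_eq_zero hlam hr hG hd]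
    exact OnePhase.largest_le hgpos hh hy
  have huM : ∀ x ∉ D, u x ≤ g z₂ := fun x hx => by
    rw [hu]
    exact OnePhase.largest_le_of_boundary_le hD hgpos hh hg₂.le hgM hx
  have huG : ∀ x ∉ D, u x ≤ G := fun x hx => (huM x hx).trans (hgG z₂ hz₂)
  have hgrow : ∀ x ∈ OnePhase.posSet D u,
      infDist x (OnePhase.freeBoundary D u) ≤ infDist x D →
      u x ≤ 40 * √Lam * infDist x (OnePhase.freeBoundary D u) := by
    intro x hx hd
    rw [hu] at hx hd hne ⊢
    exact OnePhase.largest_le_mul_infDist hD hlam hLam hr hG hp hg₁ hgm hfs hWadm hWfr hne hx hd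
  have hFc : IsClosed (OnePhase.freeBoundary D u) := OnePhase.isClosed_freeBoundary hD
  have hdpos : ∀ x ∈ OnePhase.posSet D u, 0 < infDist x (OnePhase.freeBoundary D u) := by
    intro x hx
    refine (hFc.notMem_iff_infDist_pos hne).1 ?_
    rw [hu]
    exact OnePhase.notMem_freeBoundary_largest hgpos hh (hu ▸ hx.2)
  have hdiff : ∀ x, x ∉ closure D → 0 < u x → DifferentiableAt ℝ u x := by
    intro x hx hpos
    rw [hu] at hpos ⊢
    exact (OnePhase.harmonicAt_largest hD hgpos hh hx hpos).1.differentiableAt (by norm_num)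
  have hgrad : ∀ x ∈ OnePhase.posSet D u, ∀ d, 0 < d → d ≤ infDist x D →
      d ≤ infDist x (OnePhase.freeBoundary D u) → ‖fderiv ℝ u x‖ ≤ 8 * u x / d := by
    intro x hx d hd hdD hdF
    rw [hu] at hx hdF ⊢
    exact OnePhase.norm_fderiv_largest_le hD hgpos hh hd hx hdD hdF
  have hgrad' : ∀ x ∈ OnePhase.posSet D u,
      infDist x (OnePhase.freeBoundary D u) ≤ infDist x D → ‖fderiv ℝ u x‖ ≤ 320 * √Lam := by
    intro x hx hd
    have hd0 := hdpos x hx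
    refine (hgrad x hx _ hd0 hd le_rfl).trans ?_
    rw [div_le_iff₀ hd0]
    linarith [hgrow x hx hd]
  refine ⟨fun x hx => ?_, fun x hx hd => ?_, fun x hx hxD => ⟨hdiff x hxD hx.2, hgrad' x hx⟩,
    fun δ' hδ' => ?_⟩
  · have hd0 := hdpos x hx
    rcases le_or_gt (infDist x (OnePhase.freeBoundary D u)) (infDist x D) with hd | hd
    · refine (hgrow x hx hd).trans ?_
      gcongr
      have : 0 ≤ 2 * g z₂ / δ₀ := by positivity
      linarith
    · obtain ⟨z, hzF, hzd⟩ := hFc.exists_infDist_eq_dist hne x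
      have hz0 : u z ≤ 0 := OnePhase.nonpos_of_mem_freeBoundary (hlsc z hzF.1.1) hzF
      have h1 : δ₀ ≤ infDist z D := by
        by_contra! hlt
        linarith [hupos z hzF.1.1 hlt]
      have h2 := infDist_le_infDist_add_dist (s := D) (x := z) (y := x)
      rw [dist_comm z x] at h2
      have h3 : δ₀ ≤ 2 * infDist x (OnePhase.freeBoundary D u) := by linarith
      have h4 : g z₂ ≤ 2 * g z₂ / δ₀ * infDist x (OnePhase.freeBoundary D u) := by
        rw [div_mul_eq_mul_div, le_div_iff₀ hδ₀]
        nlinarith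
      have h5 : 0 ≤ 40 * √Lam * infDist x (OnePhase.freeBoundary D u) := by positivity
      linarith [huM x hx.1]
  · have h1 : 40 * √Lam ≤ 320 * √Lam := by linarith [Real.sqrt_nonneg Lam]
    exact (hgrow x hx hd).trans (mul_le_mul_of_nonneg_right h1 (hdpos x hx).le)
  · have hGδ : 0 < G / δ' := by positivity
    have hmax1 : √Lam ≤ max (√Lam) (G / δ') := le_max_left _ _
    have hmax2 : G / δ' ≤ max (√Lam) (G / δ') := le_max_right _ _
    have hL0 : 0 ≤ 320 * max (√Lam) (G / δ') := by positivity
    have hnotD : ∀ x, 0 < infDist x D → x ∉ D := fun x hx h =>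
      OnePhase.notMem_closure_of_infDist_pos hx (subset_closure h)
    refine LipschitzOnWith.of_le_add_mul _ fun x hx y hy => ?_
    have hx' : δ' ≤ infDist x D := hx
    have hy' : δ' ≤ infDist y D := hy
    rw [Real.coe_toNNReal _ hL0]
    have hxD := hnotD x (hδ'.trans_le hx')
    have hyD := hnotD y (hδ'.trans_le hy')
    rcases le_or_gt δ' (dist x y) with hfar | hnear
    · have h1 : G ≤ G / δ' * dist x y := by
        rw [div_mul_eq_mul_div, le_div_iff₀ hδ']
        gcongr
      have h2 : G / δ' * dist x y ≤ 320 * max (√Lam) (G / δ') * dist x y := by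
        gcongr
        linarith
      linarith [huG x hxD, hunn y hyD]
    · have hseg : ∀ z ∈ segment ℝ y x, δ' / 2 ≤ infDist z D := by
        intro z hz
        have h1 := dist_add_dist_of_mem_segment hz
        have h2 := infDist_le_infDist_add_dist (s := D) (x := x) (y := z)
        have h3 := infDist_le_infDist_add_dist (s := D) (x := y) (y := z)
        rw [dist_comm x z] at h2
        rw [dist_comm y x] at h1
        by_contra! hlt
        linarith
      have hcl : ∀ z ∈ segment ℝ y x, z ∉ closure D := fun z hz =>
        OnePhase.notMem_closure_of_infDist_pos (by linarith [hseg z hz])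
      refine OnePhase.le_add_mul_dist_of_fderiv_le hL0 (hunn y hyD) (fun z hz => ?_)
        (fun z hz hpos => ⟨hdiff z (hcl z hz) hpos, ?_⟩)
      · exact OnePhase.continuousAt_of_linear_growth (hcl z hz) hunn
          (fun hpos => (hdiff z (hcl z hz) hpos).continuousAt) (by positivity) hgrow hconn.nonempty
      · have hzD : z ∉ D := fun h => hcl z hz (subset_closure h)
        have hzP : z ∈ OnePhase.posSet D u := ⟨hzD, hpos⟩
        rcases le_or_gt (infDist z (OnePhase.freeBoundary D u)) (infDist z D) with hd | hd
        · exact (hgrad' z hzP hd).trans (by gcongr)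
        · refine (hgrad z hzP (δ' / 2) (by positivity) (hseg z hz)
            ((hseg z hz).trans hd.le)).trans ?_
          have h1 : 8 * u z / (δ' / 2) ≤ 16 * (G / δ') := by
            rw [div_le_iff₀ (by positivity)]
            have : 16 * (G / δ') * (δ' / 2) = 8 * G := by field_simp; ring
            linarith [huG z hzD]
          linarith
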